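/- **Setting.** A microgrid has nodes $\mathcal N=\{0,\dots,N\}$ (node $0$ is the point of common coupling, PCC), lines forming the edge set $\mathcal E$ of a simple graph on $\mathcal N$, phases $\mathcal P_n\subseteq\{a,b,c\}$ at node $n$ and $\mathcal P_{mn}\subseteq\mathcal P_m\cap\mathcal P_n$ on line $(m,n)$, invertible line impedance matrices $Z_{mn}$ and shunt admittances $Y^{(s)}_{mn}$, generation nodes $\mathcal S\subseteq\mathcal N$, and real data $P_L,Q_L,y_C$ (per node and phase) and $V^{\min},V^{\max},P_G^{\min},P_G^{\max},Q_G^{\min},Q_G^{\max}$, $c$ (per node). Matrices are indexed by the pairs $(n,\phi)$, $\phi\in\mathcal P_n$. The admittance matrix $Y$ has the block $-Z_{mn}^{-1}$ for each line and the diagonal blocks $\sum_{m:(m,n)\in\mathcal E}(\tfrac12 Y^{(s)}_{mn}+Z_{mn}^{-1})$ (zero-padded). With $e_n^\phi$ the canonical basis vectors and $Y_n^\phi=e_n^\phi (e_n^\phi)^{T}Y$, put $\Phi^\phi_{P,n}=\tfrac12(Y_n^\phi+(Y_n^\phi)^H)$, $\Phi^\phi_{Q,n}=\tfrac{\mathrm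 j}{2}(Y_n^\phi-(Y_n^\phi)^H)$, $\Phi^\phi_{V,n}=e_n^\phi (e_n^\phi)^{T}$, and $\Phi_{m\to n}=\tfrac12(A^HB+B^HA)$, where $Av=Z_{mn}^{-1}([v_m]_{\mathcal P_{mn}}-[v_n]_{\mathcal P_{mn}})$ and $Bv=[v_m]_{\mathcal P_{mn}}$. The *centralized SDP* minimizes, over $V\succeq0$, either the loss cost $\tilde C_1(V)=\sum_{(m,n)\in\mathcal E}\mathrm{Tr}((\Phi_{m\to n}+\Phi_{n\to m})V)$ or the supply cost $\tilde C_2(V)=\sum_{s\in\mathcal S\cup\{0\}}c_s\sum_{\phi\in\mathcal P_s}\mathrm{Tr}(\Phi^\phi_{P,s}V)$, subject, for all phases $\phi\in\mathcal P_n$, to: $\mathrm{Tr}(\Phi^\phi_{P,n}V)+P^\phi_{L,n}=0$ and $\mathrm{Tr}(\Phi^\phi_{Q,n}V)+Q^\phi_{L,n}-y^\phi_{C,n}\mathrm{Tr}(\Phi^\phi_{V,n}V)=0$ for $n\notin\mathcal S$; $P^{\min}_{G,n}\le\mathrm{Tr}(\Phi^\phi_{P,n}V)+P^\phi_{L,n}\le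 P^{\max}_{G,n}$ and $Q^{\min}_{G,n}\le\mathrm{Tr}(\Phi^\phi_{Q,n}V)+Q^\phi_{L,n}\le Q^{\max}_{G,n}$ for $n\in\mathcal S$; $(V_n^{\min})^2\le\mathrm{Tr}(\Phi^\phi_{V,n}V)\le(V_n^{\max})^2$ for all $n$; and $[V]_{\mathcal P_0,\mathcal P_0}=v_0v_0^H$ with $v_0$ given. The nodes are partitioned into areas $\mathcal A^{(1)},\dots,\mathcal A^{(L)}$; the extended area $\bar{\mathcal A}^{(l)}$ is $\mathcal A^{(l)}$ together with the nodes of other areas joined to it by a line. Distinct areas $l,j$ are *neighbors*, $j\in\bar{\mathcal N}^{(l)}$, if $\bar{\mathcal A}^{(l)}\cap\bar{\mathcal A}^{(j)}\ne\emptyset$. For a local matrix $V^{(l)}$, indexed by the pairs $(n,\phi)$ with $n\in\bar{\mathcal A}^{(l)}$, let $V^{(l)}_j$ be its submatrix on the nodes of $\bar{\mathcal A}^{(l)}\cap\bar{\mathcal A}^{(j)}$. Let $\mathcal B^{(l)}$ be the set of $V^{(l)}$ satisfying the above constraints (with the $\Phi$'s restricted to $\bar{\mathcal A}^{(l)}$)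 for the nodes $n\in\mathcal A^{(l)}$, including the PCC constraint if $0\in\mathcal A^{(l)}$. The local costs $\tilde C^{(l)}$ are, for losses, the sum of $\mathrm{Tr}((\Phi_{m\to n}+\Phi_{n\to m})V^{(l)})$ over the lines inside $\mathcal A^{(l)}$ plus half of it over the lines joining $\mathcal A^{(l)}$ to other areas; for the supply cost, any real affine functions of $V^{(l)}$ whose sum equals $\tilde C_2(V)$ for all feasible $V$ of the centralized SDP. The consensus form of the problem is: minimize $\sum_l\tilde C^{(l)}(V^{(l)})$ subject to $V^{(l)}\succeq0$, $V^{(l)}\in\mathcal B^{(l)}$, $\Re V^{(l)}_j=W^{(j)}_l$, $\Im V^{(l)}_j=X^{(j)}_l$, $W^{(j)}_l=W^{(l)}_j$, $X^{(j)}_l=X^{(l)}_j$ ($j\in\bar{\mathcal N}^{(l)}$). With multipliers $\Gamma^{(l)}_j,\Lambda^{(l)}_j$ of the first two groups of equalities and $\kappa>0$, its partial augmented Lagrangian is $$\mathcal L=\sum_l\Big\{\tilde C^{(l)}(V^{(l)})+\sum_{j\in\bar{\mathcal N}^{(l)}}\big[\mathrm{Tr}((\Gamma^{(l)}_j)^T(\Re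 V^{(l)}_j-W^{(j)}_l))+\mathrm{Tr}((\Lambda^{(l)}_j)^T(\Im V^{(l)}_j-X^{(j)}_l))+\tfrac\kappa2\|\Re V^{(l)}_j-W^{(j)}_l\|_F^2+\tfrac\kappa2\|\Im V^{(l)}_j-X^{(j)}_l\|_F^2\big]\Big\}.$$ ADMM iterates: [S1] $\{V^{(l)}(i+1)\}$ minimizes $\mathcal L$ over $V^{(l)}\succeq0$, $V^{(l)}\in\mathcal B^{(l)}$, with $W,X,\Gamma,\Lambda$ fixed at step $i$; [S2] $(W(i+1),X(i+1))$ minimizes $\mathcal L$ at $V(i+1),\Gamma(i),\Lambda(i)$ subject to $W^{(j)}_l=W^{(l)}_j$, $X^{(j)}_l=X^{(l)}_j$; [S3] $\Gamma^{(l)}_j(i+1)=\Gamma^{(l)}_j(i)+\kappa(\Re V^{(l)}_j(i+1)-W^{(j)}_l(i+1))$ and $\Lambda^{(l)}_j(i+1)=\Lambda^{(l)}_j(i)+\kappa(\Im V^{(l)}_j(i+1)-X^{(j)}_l(i+1))$. The *local updates* are: [S1′] for each $l$, $V^{(l)}(i+1)$ is the matrix part of a solution of $$\min\ \tilde C^{(l)}(V^{(l)})+\sum_{j\in\bar{\mathcal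 N}^{(l)}}\Big[\tfrac\kappa2(\alpha_j+\beta_j)+\mathrm{Tr}(\Gamma^{(l)}_j(i)^T\Re V^{(l)}_j)+\mathrm{Tr}(\Lambda^{(l)}_j(i)^T\Im V^{(l)}_j)\Big]$$ over $V^{(l)}\succeq0$, $V^{(l)}\in\mathcal B^{(l)}$, $\alpha_j,\beta_j\ge0$, subject to $\begin{bmatrix}-\alpha_j&r_{j,\Re}^T\\ r_{j,\Re}&-I\end{bmatrix}\preceq0$ and $\begin{bmatrix}-\beta_j&r_{j,\Im}^T\\ r_{j,\Im}&-I\end{bmatrix}\preceq0$ for $j\in\bar{\mathcal N}^{(l)}$, where $r_{j,\Re},r_{j,\Im}$ collect the real and imaginary parts of the entries of $V^{(l)}_j-\tfrac12(V^{(l)}_j(i)+V^{(j)}_l(i))$; [S2′] $\Gamma^{(l)}_j(i+1)=\Gamma^{(l)}_j(i)+\tfrac\kappa2(\Re V^{(l)}_j(i+1)-\Re V^{(j)}_l(i+1))$ and $\Lambda^{(l)}_j(i+1)=\Lambda^{(l)}_j(i)+\tfrac\kappa2(\Im V^{(l)}_j(i+1)-\Im V^{(j)}_l(i+1))$. **Proposition.**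 Assume (As1) the graph on the areas with edges given by the neighbor relation is a tree, and (As2) $\bar{\mathcal A}^{(l)}\not\subseteq\bar{\mathcal A}^{(i)}$ for $i\ne l$. Let $\kappa>0$ and $\Gamma^{(l)}_j(0)=\Lambda^{(l)}_j(0)=0$ for all neighboring $l,j$. 1. Every run of [S1]–[S3] satisfies [S2′] for all $i\ge0$ and [S1′] for all $i\ge1$, and also [S1′] for $i=0$ if $W^{(l)}_j(0)+\mathrm j X^{(l)}_j(0)=\tfrac12(V^{(l)}_j(0)+V^{(j)}_l(0))$. Conversely, every run of [S1′]–[S2′] is, with $W^{(l)}_j(i)+\mathrm j X^{(l)}_j(i):=\tfrac12(V^{(l)}_j(i)+V^{(j)}_l(i))$, a run of [S1]–[S3]. 2. Suppose that the centralized SDP has an optimal solution $V_{\rm opt}$ and that Lagrange multipliers for the coupling constraints exist: there are $\Gamma^\star,\Lambda^\star$ such that the ordinary partial Lagrangian ($\mathcal L$ with $\kappa=0$) at $\Gamma^\star,\Lambda^\star$ is at least the optimal value $\sum_l\tilde C^{(l)}(V^{(l)}_{\rm opt})$ for all $V^{(l)}\succeq0$, $V^{(l)}\in\mathcal B^{(l)}$,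 $W^{(j)}_l=W^{(l)}_j$, $X^{(j)}_l=X^{(l)}_j$. Then for every run of [S1′]–[S2′] the multipliers $\Gamma^{(l)}_j(i),\Lambda^{(l)}_j(i)$ converge, the matrices $V^{(l)}(i)$ are bounded, and every limit point of $\{V^{(l)}(i)\}_l$ consists of the submatrices of an optimal solution of the centralized SDP. If moreover the optimal solution is unique (or at least all optimal solutions have the same submatrices on the extended areas), then $\lim_{i\to\infty}V^{(l)}(i)=V^{(l)}_{\rm opt}$ for all $l$, with $V^{(l)}_{\rm opt}$ the submatrix of $V_{\rm opt}$ on $\bar{\mathcal A}^{(l)}$. -/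

import Mathlib

open Filter Topology Matrix

noncomputable section

open scoped Classical ComplexOrder

/-- Data of a multi-phase microgrid with nodes `0, …, N`; node `0` is the point of common coupling
(PCC). The three phases are `Fin 3`, lines are the edges of a simple graph, and line data are indexed
by unordered pairs of nodes. -/
structure Microgrid (N : ℕ) where
  /-- distribution lines -/
  lines : SimpleGraph (Fin (N + 1))
  /-- phases present at a node -/
  phases : Fin (N + 1) → Finset (Fin 3)
  /-- phases present on a line -/
  linePhases : Sym2 (Fin (N + 1)) → Finset (Fin 3)
  linePhases_subset : ∀ m n, lines.Adj m n → linePhases s(m, n) ⊆ phases m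
  /-- phase impedance matrix of a line -/
  Z : ∀ e, Matrix (linePhases e) (linePhases e) ℂ
  Z_isUnit : ∀ e ∈ lines.edgeSet, IsUnit (Z e).det
  /-- shunt admittance matrix of a line -/
  Ysh : ∀ e, Matrix (linePhases e) (linePhases e) ℂ
  /-- reference voltages at the PCC -/
  v₀ : Fin 3 → ℂ
  /-- nodes with distributed generation -/
  S : Finset (Fin (N + 1))
  /-- active loads -/
  PL : Fin (N + 1) → Fin 3 → ℝ
  /-- reactive loads -/
  QL : Fin (N + 1) → Fin 3 → ℝ
  /-- capacitor susceptances (zero where there is no capacitor) -/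
  yC : Fin (N + 1) → Fin 3 → ℝ
  Vmin : Fin (N + 1) → ℝ
  Vmax : Fin (N + 1) → ℝ
  PGmin : Fin (N + 1) → ℝ
  PGmax : Fin (N + 1) → ℝ
  QGmin : Fin (N + 1) → ℝ
  QGmax : Fin (N + 1) → ℝ
  /-- cost coefficients of supplied power -/
  c : Fin (N + 1) → ℝ

/-- The two objectives: power losses, cost of supplied power. -/
inductive Objective
  | losses
  | supply

namespace Microgrid

variable {N : ℕ} (D : Microgrid N)

/-- Pairs (node, phase of that node): the index set of the vector of all voltages. -/
abbrev Idx : Type := {x : Fin (N + 1) × Fin 3 // x.2 ∈ D.phases x.1}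

/-- A matrix on the phases of a line, padded with zeros to all phases. -/
def pad (e : Sym2 (Fin (N + 1))) (M : Matrix (D.linePhases e) (D.linePhases e) ℂ) :
    Matrix (Fin 3) (Fin 3) ℂ :=
  fun a b => if h : a ∈ D.linePhases e ∧ b ∈ D.linePhases e then M ⟨a, h.1⟩ ⟨b, h.2⟩ else 0

/-- The (padded) series admittance `Z⁻¹` of a line. -/
def Zinv (e : Sym2 (Fin (N + 1))) : Matrix (Fin 3) (Fin 3) ℂ := D.pad e (D.Z e)⁻¹

/-- The bus admittance matrix. -/
def Y : Matrix D.Idx D.Idx ℂ := fun x y =>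
  if x.1.1 = y.1.1 then
    ∑ m ∈ D.lines.neighborFinset x.1.1,
      ((1 / 2 : ℂ) * D.pad s(m, x.1.1) (D.Ysh s(m, x.1.1)) x.1.2 y.1.2
        + D.Zinv s(m, x.1.1) x.1.2 y.1.2)
  else if D.lines.Adj x.1.1 y.1.1 then -D.Zinv s(x.1.1, y.1.1) x.1.2 y.1.2
  else 0

/-- `e eᵀ` for the canonical basis vector `e` attached to a (node, phase) pair. -/
def ΦV (x : D.Idx) : Matrix D.Idx D.Idx ℂ :=
  vecMulVec (Pi.single x 1) (Pi.single x 1)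

/-- `e eᵀ Y`. -/
def Yat (x : D.Idx) : Matrix D.Idx D.Idx ℂ := D.ΦV x * D.Y

def ΦP (x : D.Idx) : Matrix D.Idx D.Idx ℂ := (1 / 2 : ℂ) • (D.Yat x + (D.Yat x)ᴴ)

def ΦQ (x : D.Idx) : Matrix D.Idx D.Idx ℂ := (Complex.I / 2) • (D.Yat x - (D.Yat x)ᴴ)

/-- The matrix `A_{m → n}`, with `A_{m → n} v` the series current from `m` to `n`. -/
def Aline (m n : Fin (N + 1)) : Matrix (D.linePhases s(m, n)) D.Idx ℂ := fun φ x =>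
  if x.1.1 = m then D.Zinv s(m, n) φ.1 x.1.2
  else if x.1.1 = n then -D.Zinv s(m, n) φ.1 x.1.2
  else 0

/-- The matrix `B_m`, with `B_m v` the voltages of node `m` on the phases of the line. -/
def Bline (m n : Fin (N + 1)) : Matrix (D.linePhases s(m, n)) D.Idx ℂ := fun φ x =>
  if x.1.1 = m ∧ x.1.2 = φ.1 then 1 else 0

/-- The matrix `Φ_{m → n}` of the active power leaving `m` on the line to `n`. -/
def Φflow (m n : Fin (N + 1)) : Matrix D.Idx D.Idx ℂ :=
  (1 / 2 : ℂ) • ((D.Aline m n)ᴴ * D.Bline m n + (D.Bline m n)ᴴ * D.Aline m n)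

/-- `Φ_{m ↔ n} = Φ_{m → n} + Φ_{n → m}`, for the line `{m, n}`. -/
def Φline : Sym2 (Fin (N + 1)) → Matrix D.Idx D.Idx ℂ :=
  Sym2.lift ⟨fun m n => D.Φflow m n + D.Φflow n m, fun _ _ => add_comm _ _⟩

/-- `Tr (Φ V)`, as a real number (it is real for Hermitian `Φ` and `V`). -/
def tr {ι : Type} [Fintype ι] (Φ V : Matrix ι ι ℂ) : ℝ := (Φ * V).trace.re

/-- The cost of the centralized problem. -/
def cost : Objective → Matrix D.Idx D.Idx ℂ → ℝ
  | .losses, V => ∑ e ∈ D.lines.edgeFinset, tr (D.Φline e) V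
  | .supply, V => ∑ s ∈ insert 0 D.S, D.c s * ∑ x : D.Idx with x.1.1 = s, tr (D.ΦP x) V

/-- The constraints of the centralized SDP. -/
structure FeasibleSDP (V : Matrix D.Idx D.Idx ℂ) : Prop where
  loadP : ∀ x : D.Idx, x.1.1 ∉ D.S → tr (D.ΦP x) V + D.PL x.1.1 x.1.2 = 0
  loadQ : ∀ x : D.Idx, x.1.1 ∉ D.S →
    tr (D.ΦQ x) V + D.QL x.1.1 x.1.2 - D.yC x.1.1 x.1.2 * tr (D.ΦV x) V = 0
  genP : ∀ x : D.Idx, x.1.1 ∈ D.S →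
    tr (D.ΦP x) V + D.PL x.1.1 x.1.2 ∈ Set.Icc (D.PGmin x.1.1) (D.PGmax x.1.1)
  genQ : ∀ x : D.Idx, x.1.1 ∈ D.S →
    tr (D.ΦQ x) V + D.QL x.1.1 x.1.2 ∈ Set.Icc (D.QGmin x.1.1) (D.QGmax x.1.1)
  voltage : ∀ x : D.Idx,
    tr (D.ΦV x) V ∈ Set.Icc (D.Vmin x.1.1 ^ 2) (D.Vmax x.1.1 ^ 2)
  pcc : ∀ x y : D.Idx, x.1.1 = 0 → y.1.1 = 0 → V x y = D.v₀ x.1.2 * star (D.v₀ y.1.2)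
  psd : V.PosSemidef

/-- `V` is an optimal solution of the centralized SDP. -/
def OptimalSDP (m : Objective) (V : Matrix D.Idx D.Idx ℂ) : Prop :=
  D.FeasibleSDP V ∧ ∀ V', D.FeasibleSDP V' → D.cost m V ≤ D.cost m V'

end Microgrid

/-- A microgrid partitioned into `L` areas; `area n` is the area of the node `n`. -/
structure PartitionedMicrogrid (N L : ℕ) extends Microgrid N where
  area : Fin (N + 1) → Fin L

namespace PartitionedMicrogrid

variable {N L : ℕ} (D : PartitionedMicrogrid N L)

abbrev Idx : Type := D.toMicrogrid.Idx

/-- Nodes of the area `l`. -/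
def A (l : Fin L) : Set (Fin (N + 1)) := {n | D.area n = l}

/-- Extended area: the area and the nodes of other areas connected to it by a line. -/
def ext (l : Fin L) : Set (Fin (N + 1)) :=
  D.A l ∪ {n | n ∉ D.A l ∧ ∃ m ∈ D.A l, D.lines.Adj m n}

/-- The macro graph: distinct areas are adjacent when their extended areas overlap. -/
def macroGraph : SimpleGraph (Fin L) where
  Adj l j := l ≠ j ∧ (D.ext l ∩ D.ext j).Nonempty
  symm := ⟨fun _ _ h => ⟨h.1.symm, by simpa [Set.inter_comm] using h.2⟩⟩
  loopless := ⟨fun _ h => h.1 rfl⟩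

/-- Neighboring areas of the area `l`. -/
def nbr (l : Fin L) : Finset (Fin L) := D.macroGraph.neighborFinset l

/-- The macro graph is a tree. -/
def MacroTree : Prop := D.macroGraph.IsTree

/-- There are no nested extended areas. -/
def NoNested : Prop := ∀ l i : Fin L, i ≠ l → 0 < (D.ext l \ (D.ext l ∩ D.ext i)).ncard

/-- Indices of the voltages in the extended area `l`. -/
abbrev AreaIdx (l : Fin L) : Type := {x : D.Idx // x.1.1 ∈ D.ext l}

/-- Indices of the voltages shared by the extended areas `l` and `j`. -/
abbrev SharedIdx (l j : Fin L) : Type := {x : D.Idx // x.1.1 ∈ D.ext l ∩ D.ext j}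

abbrev AreaMat (l : Fin L) : Type := Matrix (D.AreaIdx l) (D.AreaIdx l) ℂ

/-- Families of real matrices, one per ordered pair of areas, indexed by the shared voltages.
Only the entries for neighboring pairs are ever used. -/
abbrev PairMat : Type := ∀ l j : Fin L, Matrix (D.SharedIdx l j) (D.SharedIdx l j) ℝ

/-- The submatrix of a global matrix that belongs to the extended area `l`. -/
def restrict (l : Fin L) (V : Matrix D.Idx D.Idx ℂ) : D.AreaMat l :=
  V.submatrix Subtype.val Subtype.val

/-- `V^(l)_j`: the submatrix of `V^(l)` for the voltages shared with the area `j`. -/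
def block (l j : Fin L) (V : D.AreaMat l) : Matrix (D.SharedIdx l j) (D.SharedIdx l j) ℂ :=
  V.submatrix (fun x => ⟨x.1, x.2.1⟩) (fun x => ⟨x.1, x.2.1⟩)

/-- The same matrix, with its index set written as that of the pair `(l, j)` instead of `(j, l)`. -/
def flip {R : Type} {l j : Fin L} (M : Matrix (D.SharedIdx j l) (D.SharedIdx j l) R) :
    Matrix (D.SharedIdx l j) (D.SharedIdx l j) R :=
  M.submatrix (fun x => ⟨x.1, x.2.symm⟩) (fun x => ⟨x.1, x.2.symm⟩)

/-- The constraints `V^(l) ∈ B^(l)` of the area `l`. -/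
structure InB (l : Fin L) (V : D.AreaMat l) : Prop where
  loadP : ∀ x : D.Idx, x.1.1 ∈ D.A l → x.1.1 ∉ D.S →
    Microgrid.tr (D.restrict l (D.ΦP x)) V + D.PL x.1.1 x.1.2 = 0
  loadQ : ∀ x : D.Idx, x.1.1 ∈ D.A l → x.1.1 ∉ D.S →
    Microgrid.tr (D.restrict l (D.ΦQ x)) V + D.QL x.1.1 x.1.2
      - D.yC x.1.1 x.1.2 * Microgrid.tr (D.restrict l (D.ΦV x)) V = 0
  genP : ∀ x : D.Idx, x.1.1 ∈ D.A l → x.1.1 ∈ D.S →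
    Microgrid.tr (D.restrict l (D.ΦP x)) V + D.PL x.1.1 x.1.2
      ∈ Set.Icc (D.PGmin x.1.1) (D.PGmax x.1.1)
  genQ : ∀ x : D.Idx, x.1.1 ∈ D.A l → x.1.1 ∈ D.S →
    Microgrid.tr (D.restrict l (D.ΦQ x)) V + D.QL x.1.1 x.1.2
      ∈ Set.Icc (D.QGmin x.1.1) (D.QGmax x.1.1)
  voltage : ∀ x : D.Idx, x.1.1 ∈ D.A l →
    Microgrid.tr (D.restrict l (D.ΦV x)) V ∈ Set.Icc (D.Vmin x.1.1 ^ 2) (D.Vmax x.1.1 ^ 2)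
  pcc : 0 ∈ D.A l → ∀ x y : D.AreaIdx l, x.1.1.1 = 0 → y.1.1.1 = 0 →
    V x y = D.v₀ x.1.1.2 * star (D.v₀ y.1.1.2)

/-- The local constraint set `{V^(l) ⪰ 0, V^(l) ∈ B^(l)}`. -/
def localSet (l : Fin L) : Set (D.AreaMat l) := {V | V.PosSemidef ∧ D.InB l V}

/-- The local loss cost: lines inside the area count fully, lines to another area count half. -/
def lossCost (l : Fin L) (V : D.AreaMat l) : ℝ :=
  (∑ e ∈ D.lines.edgeFinset with ∀ n ∈ e, n ∈ D.A l,
      Microgrid.tr (D.restrict l (D.Φline e)) V)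
  + ∑ e ∈ D.lines.edgeFinset with (∃ m ∈ e, m ∈ D.A l) ∧ ∃ n ∈ e, n ∈ D.ext l \ D.A l,
      (1 / 2 : ℝ) * Microgrid.tr (D.restrict l (D.Φline e)) V

/-- Admissible local costs. For the losses they are the explicit ones above. For the cost of supplied
power the splitting is not unique: any real affine functions of the local matrices that add up to the
global cost on the feasible set of the centralized problem are admitted. -/
def IsLocalCost (C : ∀ l, D.AreaMat l → ℝ) : Objective → Prop
  | .losses => ∀ l, C l = D.lossCost l
  | .supply => (∀ l, ∃ f : D.AreaMat l →ᵃ[ℝ] ℝ, C l = f) ∧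
      ∀ V, D.FeasibleSDP V → ∑ l, C l (D.restrict l V) = D.cost .supply V

/-- Squared Frobenius norm of a real matrix. -/
def frobSq {ι : Type} [Fintype ι] (M : Matrix ι ι ℝ) : ℝ := ∑ a, ∑ b, M a b ^ 2

/-- The partial Lagrangian of the consensus form of the problem (minimize `∑ C l (V l)` over the local
constraint sets subject to `Re V^(l)_j = W^(j)_l`, `Im V^(l)_j = X^(j)_l`, `W^(j)_l = W^(l)_j`,
`X^(j)_l = X^(l)_j`) with the first two groups of constraints dualized, quadratically augmented with
the constant `κ` (for `κ = 0` it is the ordinary partial Lagrangian). -/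
def lagrangian (C : ∀ l, D.AreaMat l → ℝ) (κ : ℝ) (V : ∀ l, D.AreaMat l)
    (W X Γ Λ : D.PairMat) : ℝ :=
  ∑ l, (C l (V l) + ∑ j ∈ D.nbr l,
    (((Γ l j)ᵀ * ((D.block l j (V l)).map Complex.re - D.flip (W j l))).trace
      + ((Λ l j)ᵀ * ((D.block l j (V l)).map Complex.im - D.flip (X j l))).trace
      + κ / 2 * frobSq ((D.block l j (V l)).map Complex.re - D.flip (W j l))
      + κ / 2 * frobSq ((D.block l j (V l)).map Complex.im - D.flip (X j l))))

/-- `W^(j)_l = W^(l)_j` for all neighboring areas. -/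
def Consensus (W : D.PairMat) : Prop := ∀ l, ∀ j ∈ D.nbr l, D.flip (W j l) = W l j

/-- The sequences are produced by ADMM: minimize the augmented Lagrangian over the local
matrices (S1), then over the auxiliary variables (S2), then update the multipliers (S3). -/
structure IsADMM (C : ∀ l, D.AreaMat l → ℝ) (κ : ℝ) (V : ℕ → ∀ l, D.AreaMat l)
    (W X Γ Λ : ℕ → D.PairMat) : Prop where
  S1_mem : ∀ i l, V (i + 1) l ∈ D.localSet l
  S1_min : ∀ i, IsMinOn (fun U => D.lagrangian C κ U (W i) (X i) (Γ i) (Λ i))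
    {U | ∀ l, U l ∈ D.localSet l} (V (i + 1))
  S2_mem : ∀ i, D.Consensus (W (i + 1)) ∧ D.Consensus (X (i + 1))
  S2_min : ∀ i, IsMinOn
    (fun p : D.PairMat × D.PairMat => D.lagrangian C κ (V (i + 1)) p.1 p.2 (Γ i) (Λ i))
    {p | D.Consensus p.1 ∧ D.Consensus p.2} (W (i + 1), X (i + 1))
  S3_re : ∀ i l, ∀ j ∈ D.nbr l, Γ (i + 1) l j =
    Γ i l j + κ • ((D.block l j (V (i + 1) l)).map Complex.re - D.flip (W (i + 1) j l))
  S3_im : ∀ i l, ∀ j ∈ D.nbr l, Λ (i + 1) l j =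
    Λ i l j + κ • ((D.block l j (V (i + 1) l)).map Complex.im - D.flip (X (i + 1) j l))

/-- `½ (V^(l)_j + V^(j)_l)`. -/
def avg (V : ∀ l, D.AreaMat l) (l j : Fin L) : Matrix (D.SharedIdx l j) (D.SharedIdx l j) ℂ :=
  (1 / 2 : ℂ) • (D.block l j (V l) + D.flip (D.block j l (V j)))

/-- The linear matrix inequality `[[-α, rᵀ], [r, -I]] ⪯ 0`. -/
def PenaltyLMI {ι : Type} (α : ℝ) (r : ι → ℝ) : Prop :=
  (-(fromBlocks (of fun _ _ : Unit => -α) (of fun (_ : Unit) k => r k)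
    (of fun k (_ : Unit) => r k) (-1 : Matrix ι ι ℝ))).PosSemidef

/-- The vector of the entries of `V^(l)_j - ½ (V^(l)_j(i) + V^(j)_l(i))`, where the current
iterates `V^(·)(i)` are given as `Vi`. -/
def resid (Vi : ∀ l, D.AreaMat l) (l j : Fin L) (U : D.AreaMat l) :
    D.SharedIdx l j × D.SharedIdx l j → ℂ :=
  fun p => (D.block l j U - D.avg Vi l j) p.1 p.2

/-- The feasible set of the local SDP of the area `l` in the variables `V^(l)`, `α`, `β`. -/
def localFeasible (Vi : ∀ l, D.AreaMat l) (l : Fin L) :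
    Set (D.AreaMat l × (Fin L → ℝ) × (Fin L → ℝ)) :=
  {p | p.1 ∈ D.localSet l ∧ ∀ j ∈ D.nbr l, 0 ≤ p.2.1 j ∧ 0 ≤ p.2.2 j ∧
    PenaltyLMI (p.2.1 j) (fun k => (D.resid Vi l j p.1 k).re) ∧
    PenaltyLMI (p.2.2 j) (fun k => (D.resid Vi l j p.1 k).im)}

/-- The objective of the local SDP, for the current multipliers `Γ`, `Λ`. -/
def localLagrangian (C : ∀ l, D.AreaMat l → ℝ) (κ : ℝ) (Γ Λ : D.PairMat) (l : Fin L)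
    (p : D.AreaMat l × (Fin L → ℝ) × (Fin L → ℝ)) : ℝ :=
  C l p.1 + ∑ j ∈ D.nbr l, κ / 2 * (p.2.1 j + p.2.2 j)
    + ∑ j ∈ D.nbr l, (((Γ l j)ᵀ * (D.block l j p.1).map Complex.re).trace
      + ((Λ l j)ᵀ * (D.block l j p.1).map Complex.im).trace)

/-- Local primal update: in every area, the next `V^(l)` is the matrix part of a solution of the
local SDP. -/
def PrimalStep (C : ∀ l, D.AreaMat l → ℝ) (κ : ℝ) (Vi Vnext : ∀ l, D.AreaMat l)
    (Γ Λ : D.PairMat) : Prop :=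
  ∀ l, ∃ α β : Fin L → ℝ, (Vnext l, α, β) ∈ D.localFeasible Vi l ∧
    IsMinOn (D.localLagrangian C κ Γ Λ l) (D.localFeasible Vi l) (Vnext l, α, β)

/-- The local dual updates. -/
def DualStep (κ : ℝ) (Vnext : ∀ l, D.AreaMat l) (Γ Λ Γnext Λnext : D.PairMat) : Prop :=
  ∀ l, ∀ j ∈ D.nbr l,
    Γnext l j = Γ l j + (κ / 2) • ((D.block l j (Vnext l)).map Complex.re
      - (D.flip (D.block j l (Vnext j))).map Complex.re) ∧
    Λnext l j = Λ l j + (κ / 2) • ((D.block l j (Vnext l)).map Complex.im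
      - (D.flip (D.block j l (Vnext j))).map Complex.im)

/-- The multipliers are zero (for all neighboring areas). -/
def ZeroMult (Γ : D.PairMat) : Prop := ∀ l, ∀ j ∈ D.nbr l, Γ l j = 0

/-- `Γ`, `Λ` are Lagrange multipliers of the coupling constraints `Re V^(l)_j = W^(j)_l`,
`Im V^(l)_j = X^(j)_l` of the consensus form, whose optimal value is `v`: the infimum of the
ordinary partial Lagrangian over the remaining constraints is at least `v`. -/
def IsMultiplier (C : ∀ l, D.AreaMat l → ℝ) (v : ℝ) (Γ Λ : D.PairMat) : Prop :=
  ∀ (V : ∀ l, D.AreaMat l) (W X : D.PairMat), (∀ l, V l ∈ D.localSet l) →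
    D.Consensus W → D.Consensus X → v ≤ D.lagrangian C 0 V W X Γ Λ

end PartitionedMicrogrid

end

/-! Write A for the real-linear map `coupMap` from families of local matrices to the real and
imaginary parts of all shared blocks, K for `consensusSpace` (vectors unchanged when the two areas
of a pair are exchanged), and f for the total local cost. The consensus problem is to minimize f
over a closed convex set subject to A V ∈ K.

Equivalence. [S2] minimizes a quadratic over K, and its stationarity condition says exactly that the
multiplier produced by [S3] lies in Kᗮ. Zero initial multipliers lie there too, so A V(i+1) - W(i+1)
∈ Kᗮ. Hence W(i+1) is the orthogonal projection of A V(i+1) onto K, which is the average of the two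
copies of each block. Substituting it turns [S3] into [S2′]. In [S1] the linear term in W is
constant, the rest splits over the areas, and the matrix inequalities of [S1′] are Schur complements
bounding squared residuals.

Convergence. An optimum and its multipliers form a saddle point. Adding its inequality to the
optimality condition of the primal step gives `fejer`: Z = G + κ W moves no further from any saddle
point, and its increments tend to zero. Since G and κ W are the orthogonal components of Z, limit
points of the run are again saddle points; taking one of them as reference makes all of Z converge.
The local matrices are seen only through A, but voltage limits and positive semidefiniteness bound
the remaining entries (`exists_norm_le`).

Return to the centralized SDP. A limit point is a consensual family of local positive semidefinite
matrices. `exists_completion` glues it along the tree: each matrix is a Gram matrix, the vectors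
shared by two neighbors differ by an isometry, and these isometries can be chosen successively away
from a root. Every constraint of a node reads only entries in the extended area of its owner, and
the local costs add up to the global one, so the glued matrix is feasible and optimal. -/

noncomputable section

open scoped Classical ComplexOrder InnerProductSpace

/-! ### Convergence of ADMM with a subspace constraint in an inner product space -/

section ADMM

variable {E H : Type*} [AddCommGroup E] [Module ℝ E]
  [NormedAddCommGroup H] [InnerProductSpace ℝ H]

/-- First-order optimality condition for a convex function plus a quadratic penalty. -/
theorem IsMinOn.quadratic_variational {S : Set E} {f : E → ℝ} (hf : ConvexOn ℝ S f)
    (A : E →ₗ[ℝ] H) {κ : ℝ} {g w : H} {x : E} (hx : x ∈ S)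
    (hmin : IsMinOn (fun u => f u + ⟪g, A u⟫_ℝ + κ / 2 * ‖A u - w‖ ^ 2) S x) {y : E} (hy : y ∈ S) :
    f x + ⟪g + κ • (A x - w), A x - A y⟫_ℝ ≤ f y := by
  -- Compare x with the point (1 - t) x + t y: convexity bounds f there, the penalty expands to
  -- second order in t, and dividing by t leaves an error of order t.
  have key : ∀ t : ℝ, 0 < t → t ≤ 1 →
      f x + ⟪g + κ • (A x - w), A x - A y⟫_ℝ - f y ≤ t * (κ / 2 * ‖A y - A x‖ ^ 2) := by
    intro t ht ht1
    have hz : (1 - t) • x + t • y ∈ S := hf.1 hx hy (by linarith) ht.le (by ring)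
    have h1 := hf.2 hx hy (sub_nonneg.2 ht1) ht.le (by ring)
    have h2 := isMinOn_iff.1 hmin _ hz
    have e1 : A ((1 - t) • x + t • y) = A x + t • (A y - A x) := by
      rw [map_add, map_smul, map_smul]; module
    have e2 : A x + t • (A y - A x) - w = (A x - w) + t • (A y - A x) := by abel
    rw [e1, e2, norm_add_sq_real, norm_smul, inner_add_right, inner_smul_right,
      inner_smul_right, mul_pow, Real.norm_eq_abs, sq_abs] at h2
    have e3 : ⟪g + κ • (A x - w), A x - A y⟫_ℝ
        = -(⟪g, A y - A x⟫_ℝ + κ * ⟪A x - w, A y - A x⟫_ℝ) := by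
      rw [← neg_sub (A y) (A x), inner_neg_right, inner_add_left, real_inner_smul_left]
    rw [e3]
    simp only [smul_eq_mul] at h1
    have : t * (f x + -(⟪g, A y - A x⟫_ℝ + κ * ⟪A x - w, A y - A x⟫_ℝ) - f y)
        ≤ t * (t * (κ / 2 * ‖A y - A x‖ ^ 2)) := by nlinarith
    exact le_of_mul_le_mul_left this ht
  have hlim : Tendsto (fun t : ℝ => t * (κ / 2 * ‖A y - A x‖ ^ 2)) (𝓝[>] 0) (𝓝 0) := by
    have : Tendsto (fun t : ℝ => t * (κ / 2 * ‖A y - A x‖ ^ 2)) (𝓝 0)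
        (𝓝 (0 * (κ / 2 * ‖A y - A x‖ ^ 2))) := tendsto_id.mul_const _
    rw [zero_mul] at this
    exact this.mono_left nhdsWithin_le_nhds
  have := ge_of_tendsto hlim (by
    filter_upwards [Ioc_mem_nhdsGT (zero_lt_one' ℝ)] with t ht using key t ht.1 ht.2)
  linarith

/-- A run of ADMM for minimizing `f u` over `u ∈ S`, `A u ∈ K`, with the primal step replaced
by its optimality condition. The multipliers stay in the orthogonal complement of `K`. -/
structure ADMMRun (S : Set E) (f : E → ℝ) (A : E →ₗ[ℝ] H) (K : Submodule ℝ H) (κ : ℝ)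
    (V : ℕ → E) (W G : ℕ → H) : Prop where
  mem : ∀ i, V (i + 1) ∈ S
  opt : ∀ i, ∀ y ∈ S,
    f (V (i + 1)) + ⟪G (i + 1) + κ • (W (i + 1) - W i), A (V (i + 1)) - A y⟫_ℝ ≤ f y
  W_mem : ∀ i, W i ∈ K
  G_mem : ∀ i, G i ∈ Kᗮ
  step : ∀ i, G (i + 1) = G i + κ • (A (V (i + 1)) - W (i + 1))

/-- `(u, g)` is a saddle point of `f u + ⟪g, A u⟫`. -/
structure IsSaddle (S : Set E) (f : E → ℝ) (A : E →ₗ[ℝ] H) (K : Submodule ℝ H) (u : E) (g : H) :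
    Prop where
  mem : u ∈ S
  A_mem : A u ∈ K
  g_mem : g ∈ Kᗮ
  le : ∀ y ∈ S, f u ≤ f y + ⟪g, A y⟫_ℝ

namespace ADMMRun

variable {S : Set E} {f : E → ℝ} {A : E →ₗ[ℝ] H} {K : Submodule ℝ H} {κ : ℝ}
  {V : ℕ → E} {W G : ℕ → H}

/-- Fejér monotonicity of `G + κ W`. -/
theorem fejer (h : ADMMRun S f A K κ V W G) (hκ : 0 < κ) {u : E} {g : H}
    (hs : IsSaddle S f A K u g) (i : ℕ) :
    ‖G (i + 1) + κ • W (i + 1) - (g + κ • A u)‖ ^ 2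
      + ‖G (i + 1) + κ • W (i + 1) - (G i + κ • W i)‖ ^ 2 ≤ ‖G i + κ • W i - (g + κ • A u)‖ ^ 2 := by
  set Z : ℕ → H := fun i => G i + κ • W i
  have horth : ∀ a ∈ K, ∀ b ∈ Kᗮ, ⟪a, b⟫_ℝ = 0 := fun a ha b hb =>
    Submodule.inner_right_of_mem_orthogonal ha hb
  have horth' : ∀ a ∈ K, ∀ b ∈ Kᗮ, ⟪b, a⟫_ℝ = 0 := fun a ha b hb =>
    Submodule.inner_left_of_mem_orthogonal ha hb
  have hΔW : W (i + 1) - W i ∈ K := K.sub_mem (h.W_mem _) (h.W_mem _)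
  have hWs : W (i + 1) - A u ∈ K := K.sub_mem (h.W_mem _) hs.A_mem
  have hΔG : G (i + 1) - G i ∈ Kᗮ := Kᗮ.sub_mem (h.G_mem _) (h.G_mem _)
  have hGs : G (i + 1) - g ∈ Kᗮ := Kᗮ.sub_mem (h.G_mem _) hs.g_mem
  have hAV : κ • (A (V (i + 1)) - A u) = κ • (W (i + 1) - A u) + (G (i + 1) - G i) := by
    rw [h.step i]; module
  have h1 := h.opt i u hs.mem
  have h2 := hs.le _ (h.mem i)
  -- Add the optimality condition tested at u to the saddle inequality tested at the new iterate;
  -- the values of f cancel.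
  have h3 : ⟪G (i + 1) - g + κ • (W (i + 1) - W i), A (V (i + 1)) - A u⟫_ℝ ≤ 0 := by
    have : ⟪g, A u⟫_ℝ = 0 := horth' _ hs.A_mem _ hs.g_mem
    rw [inner_add_left, inner_sub_right] at h1
    rw [inner_add_left, inner_sub_left, inner_sub_right, inner_sub_right g, this]
    linarith
  have h4 : ⟪G (i + 1) - g + κ • (W (i + 1) - W i),
      κ • (W (i + 1) - A u) + (G (i + 1) - G i)⟫_ℝ ≤ 0 := by
    rw [← hAV, inner_smul_right]
    exact mul_nonpos_of_nonneg_of_nonpos hκ.le h3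
  -- This inner product and the one in `h4` differ only in cross terms pairing K with Kᗮ, and those
  -- vanish.
  have h5 : ⟪Z (i + 1) - (g + κ • A u), Z (i + 1) - Z i⟫_ℝ ≤ 0 := by
    have e1 : Z (i + 1) - (g + κ • A u) = (G (i + 1) - g) + κ • (W (i + 1) - A u) := by
      simp only [Z]; module
    have e2 : Z (i + 1) - Z i = (G (i + 1) - G i) + κ • (W (i + 1) - W i) := by
      simp only [Z]; module
    rw [e1, e2]
    simp only [inner_add_left, inner_add_right, real_inner_smul_left, real_inner_smul_right] at h4 ⊢
    rw [horth _ hΔW _ hΔG, horth' _ hWs _ hGs] at h4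
    rw [horth' _ hΔW _ hGs, horth _ hWs _ hΔG]
    rw [real_inner_comm (W (i + 1) - W i) (W (i + 1) - A u)]
    linarith
  have h6 : ‖Z i - (g + κ • A u)‖ ^ 2 = ‖Z (i + 1) - (g + κ • A u)‖ ^ 2
      - 2 * ⟪Z (i + 1) - (g + κ • A u), Z (i + 1) - Z i⟫_ℝ + ‖Z (i + 1) - Z i‖ ^ 2 := by
    rw [← norm_sub_sq_real]; congr 2; abel
  change ‖Z (i + 1) - (g + κ • A u)‖ ^ 2 + ‖Z (i + 1) - Z i‖ ^ 2 ≤ ‖Z i - (g + κ • A u)‖ ^ 2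
  linarith

theorem antitone_norm (h : ADMMRun S f A K κ V W G) (hκ : 0 < κ) {u : E} {g : H}
    (hs : IsSaddle S f A K u g) : Antitone fun i => ‖G i + κ • W i - (g + κ • A u)‖ :=
  antitone_nat_of_succ_le fun i => by
    have := h.fejer hκ hs i
    exact (pow_le_pow_iff_left₀ (norm_nonneg _) (norm_nonneg _) two_ne_zero).1
      (le_trans (le_add_of_nonneg_right (sq_nonneg _)) this)

/-- By `fejer` the squared increment is at most the drop of a nonincreasing, nonnegative, hence
convergent sequence. -/
theorem tendsto_sub_zero (h : ADMMRun S f A K κ V W G) (hκ : 0 < κ) {u : E} {g : H}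
    (hs : IsSaddle S f A K u g) :
    Tendsto (fun i => G (i + 1) + κ • W (i + 1) - (G i + κ • W i)) atTop (𝓝 0) := by
  set a : ℕ → ℝ := fun i => ‖G i + κ • W i - (g + κ • A u)‖ with ha
  obtain ⟨l, hl⟩ : ∃ l, Tendsto a atTop (𝓝 l) :=
    ⟨_, tendsto_atTop_ciInf (h.antitone_norm hκ hs) ⟨0, by rintro _ ⟨i, rfl⟩; exact norm_nonneg _⟩⟩
  have h1 : Tendsto (fun i => a i ^ 2 - a (i + 1) ^ 2) atTop (𝓝 0) := by
    simpa using (hl.pow 2).sub ((hl.comp (tendsto_add_atTop_nat 1)).pow 2)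
  have h2 := squeeze_zero (fun i => sq_nonneg ‖G (i + 1) + κ • W (i + 1) - (G i + κ • W i)‖)
    (fun i => by have := h.fejer hκ hs i; simp only [a]; linarith) h1
  rw [tendsto_zero_iff_norm_tendsto_zero]
  have h3 := h2.sqrt
  simpa [Real.sqrt_sq] using h3

variable [FiniteDimensional ℝ H]

/-- G and κ W are the components of Z in Kᗮ and K, so continuity of the projections transfers every
limit of Z to both. -/
theorem starProjection_eq_G (h : ADMMRun S f A K κ V W G) (i : ℕ) :
    Kᗮ.starProjection (G i + κ • W i) = G i := by
  refine Submodule.eq_starProjection_of_mem_of_inner_eq_zero (h.G_mem i) fun w hw => ?_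
  have : G i + κ • W i - G i = κ • W i := by abel
  rw [this, real_inner_smul_left, Submodule.inner_right_of_mem_orthogonal (h.W_mem i) hw, mul_zero]

theorem starProjection_eq_W (h : ADMMRun S f A K κ V W G) (i : ℕ) :
    K.starProjection (G i + κ • W i) = κ • W i := by
  refine Submodule.eq_starProjection_of_mem_of_inner_eq_zero (K.smul_mem _ (h.W_mem i)) fun w hw => ?_
  have : G i + κ • W i - κ • W i = G i := by abel
  rw [this, Submodule.inner_left_of_mem_orthogonal hw (h.G_mem i)]

theorem tendsto_G_sub (h : ADMMRun S f A K κ V W G) (hκ : 0 < κ) {u : E} {g : H}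
    (hs : IsSaddle S f A K u g) : Tendsto (fun i => G (i + 1) - G i) atTop (𝓝 0) := by
  have := (Kᗮ.starProjection.continuous.tendsto _).comp (h.tendsto_sub_zero hκ hs)
  simpa only [Function.comp_def, map_sub, h.starProjection_eq_G, map_zero] using this

theorem tendsto_W_sub (h : ADMMRun S f A K κ V W G) (hκ : 0 < κ) {u : E} {g : H}
    (hs : IsSaddle S f A K u g) : Tendsto (fun i => κ • (W (i + 1) - W i)) atTop (𝓝 0) := by
  have := (K.starProjection.continuous.tendsto _).comp (h.tendsto_sub_zero hκ hs)
  simp only [Function.comp_def, map_sub, h.starProjection_eq_W, map_zero] at this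
  simpa [smul_sub] using this

/-- The multiplier update makes the primal residual κ⁻¹ times the increment of G. -/
theorem tendsto_residual (h : ADMMRun S f A K κ V W G) (hκ : 0 < κ) {u : E} {g : H}
    (hs : IsSaddle S f A K u g) : Tendsto (fun i => A (V (i + 1)) - W (i + 1)) atTop (𝓝 0) := by
  have := (h.tendsto_G_sub hκ hs).const_smul κ⁻¹
  rw [smul_zero] at this
  refine this.congr fun i => ?_
  rw [h.step i, add_sub_cancel_left, smul_smul, inv_mul_cancel₀ hκ.ne', one_smul]

/-- A limit of primal iterates along which `G + κ W` converges belongs to a saddle point. -/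
theorem isSaddle_of_tendsto [TopologicalSpace E] (h : ADMMRun S f A K κ V W G) (hκ : 0 < κ)
    (hS : IsClosed S) (hf : Continuous f) (hA : Continuous A) {u : E} {g : H}
    (hs : IsSaddle S f A K u g) {φ : ℕ → ℕ} (hφ : Tendsto φ atTop atTop) {u' : E} {z : H}
    (hu : Tendsto (fun n => V (φ n + 1)) atTop (𝓝 u'))
    (hz : Tendsto (fun n => G (φ n + 1) + κ • W (φ n + 1)) atTop (𝓝 z)) :
    IsSaddle S f A K u' (Kᗮ.starProjection z) ∧ z = Kᗮ.starProjection z + κ • A u' := by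
  have hG : Tendsto (fun n => G (φ n + 1)) atTop (𝓝 (Kᗮ.starProjection z)) := by
    have := (Kᗮ.starProjection.continuous.tendsto _).comp hz
    simpa only [Function.comp_def, h.starProjection_eq_G] using this
  have hW : Tendsto (fun n => κ • W (φ n + 1)) atTop (𝓝 (K.starProjection z)) := by
    have := (K.starProjection.continuous.tendsto _).comp hz
    simpa only [Function.comp_def, h.starProjection_eq_W] using this
  have hAu : Tendsto (fun n => A (V (φ n + 1))) atTop (𝓝 (A u')) := (hA.tendsto _).comp hu
  have hres := ((h.tendsto_residual hκ hs).comp hφ).const_smul κ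
  have hKz : κ • A u' = K.starProjection z := by
    have h1 := hW.add hres
    rw [smul_zero, add_zero] at h1
    refine tendsto_nhds_unique (hAu.const_smul κ) (h1.congr fun n => ?_)
    simp only [Function.comp_apply]; module
  have hAK : A u' ∈ K := by
    have : κ⁻¹ • (κ • A u') ∈ K := by
      rw [hKz]; exact K.smul_mem _ (K.starProjection_apply_mem z)
    rwa [smul_smul, inv_mul_cancel₀ hκ.ne', one_smul] at this
  have hgK : Kᗮ.starProjection z ∈ Kᗮ := Kᗮ.starProjection_apply_mem z
  refine ⟨⟨hS.mem_of_tendsto hu (Eventually.of_forall fun n => h.mem _), hAK, hgK, fun y hy => ?_⟩, ?_⟩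
  · have h1 : Tendsto (fun n => f (V (φ n + 1)) + ⟪G (φ n + 1) + κ • (W (φ n + 1) - W (φ n)),
        A (V (φ n + 1)) - A y⟫_ℝ) atTop
        (𝓝 (f u' + ⟪Kᗮ.starProjection z + 0, A u' - A y⟫_ℝ)) :=
      ((hf.tendsto _).comp hu).add
        ((hG.add ((h.tendsto_W_sub hκ hs).comp hφ)).inner (hAu.sub_const _))
    have h2 := le_of_tendsto h1 (Eventually.of_forall fun n => h.opt (φ n) y hy)
    rw [add_zero, inner_sub_right, Submodule.inner_left_of_mem_orthogonal hAK hgK] at h2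
    linarith
  · rw [hKz, add_comm, Submodule.starProjection_add_starProjection_orthogonal]

/-- Z is bounded by monotonicity, W as its projection, and A V as W plus a convergent residual. V
itself is not controlled, since A may have a kernel. -/
theorem exists_bound (h : ADMMRun S f A K κ V W G) (hκ : 0 < κ) {u : E} {g : H}
    (hs : IsSaddle S f A K u g) :
    ∃ R, ∀ i, ‖G i + κ • W i‖ ≤ R ∧ ‖A (V (i + 1))‖ ≤ R := by
  set z := g + κ • A u
  have hZ : ∀ i, ‖G i + κ • W i‖ ≤ ‖G 0 + κ • W 0 - z‖ + ‖z‖ := fun i => by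
    have h1 := h.antitone_norm hκ hs (Nat.zero_le i)
    have h2 := norm_le_norm_sub_add (G i + κ • W i) z
    simp only at h1
    linarith
  obtain ⟨R, hR⟩ := ((h.tendsto_residual hκ hs).norm.bddAbove_range)
  set R0 := ‖G 0 + κ • W 0 - z‖ + ‖z‖
  refine ⟨max R0 (R + κ⁻¹ * R0), fun i => ⟨(hZ i).trans (le_max_left _ _), le_trans ?_ (le_max_right _ _)⟩⟩
  have h1 : ‖A (V (i + 1)) - W (i + 1)‖ ≤ R := hR ⟨i, rfl⟩
  have h2 : ‖κ • W (i + 1)‖ ≤ R0 := by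
    rw [← h.starProjection_eq_W]
    exact (K.norm_starProjection_apply_le _).trans (hZ _)
  have h3 : ‖W (i + 1)‖ ≤ κ⁻¹ * R0 := by
    rw [norm_smul, Real.norm_of_nonneg hκ.le] at h2
    rw [inv_mul_eq_div, le_div_iff₀ hκ]; linarith
  have h4 := norm_le_norm_sub_add (A (V (i + 1))) (W (i + 1))
  linarith

variable [TopologicalSpace E] [FirstCountableTopology E]

/-- Compactness supplies a limit point of Z, which comes from a saddle point. The distance of Z to
it is monotone and tends to zero along a subsequence, hence along the whole sequence. -/
theorem exists_tendsto_G (h : ADMMRun S f A K κ V W G) (hκ : 0 < κ)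
    (hS : IsClosed S) (hf : Continuous f) (hA : Continuous A) {u : E} {g : H}
    (hs : IsSaddle S f A K u g) {Q : Set E} (hQ : IsCompact Q) (hV : ∀ i, V (i + 1) ∈ Q) :
    ∃ z, Tendsto (fun i => G i + κ • W i) atTop (𝓝 z) := by
  obtain ⟨R, hR⟩ := h.exists_bound hκ hs
  obtain ⟨⟨u', z⟩, -, φ, hφ, hlim⟩ := (hQ.prod (isCompact_closedBall (0 : H) R)).tendsto_subseq
    (x := fun n => (V (n + 1), G (n + 1) + κ • W (n + 1)))
    (fun n => ⟨hV n, by simpa using (hR (n + 1)).1⟩)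
  have hu : Tendsto (fun n => V (φ n + 1)) atTop (𝓝 u') := (continuous_fst.tendsto _).comp hlim
  have hz : Tendsto (fun n => G (φ n + 1) + κ • W (φ n + 1)) atTop (𝓝 z) :=
    (continuous_snd.tendsto _).comp hlim
  obtain ⟨hs', hzz⟩ := h.isSaddle_of_tendsto hκ hS hf hA hs hφ.tendsto_atTop hu hz
  refine ⟨z, tendsto_iff_norm_sub_tendsto_zero.2 ?_⟩
  have hanti := h.antitone_norm hκ hs'
  rw [← hzz] at hanti
  refine (tendsto_iff_tendsto_subseq_of_antitone hanti
    ((tendsto_add_atTop_nat 1).comp hφ.tendsto_atTop)).2 ?_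
  exact tendsto_iff_norm_sub_tendsto_zero.1 hz

/-- Every limit point of the primal iterates is feasible and at least as good as a saddle point. -/
theorem mem_of_mapClusterPt (h : ADMMRun S f A K κ V W G) (hκ : 0 < κ)
    (hS : IsClosed S) (hf : Continuous f) (hA : Continuous A) {u : E} {g : H}
    (hs : IsSaddle S f A K u g) {Q : Set E} (hQ : IsCompact Q) (hV : ∀ i, V (i + 1) ∈ Q)
    {u' : E} (hu : MapClusterPt u' atTop V) : u' ∈ S ∧ A u' ∈ K ∧ f u' ≤ f u := by
  obtain ⟨z, hz⟩ := h.exists_tendsto_G hκ hS hf hA hs hQ hV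
  -- Only iterates from index 1 on are known to lie in S; the shift does not change the cluster
  -- points.
  have hu' : MapClusterPt u' atTop fun n => V (n + 1) := by
    unfold MapClusterPt at hu ⊢
    rwa [← Function.comp_def V, ← Filter.map_map, Filter.map_add_atTop_eq_nat]
  obtain ⟨φ, hφ, hlim⟩ := hu'.tendsto_subseq
  obtain ⟨hs', -⟩ := h.isSaddle_of_tendsto hκ hS hf hA hs hφ.tendsto_atTop hlim
    (hz.comp ((tendsto_add_atTop_nat 1).comp hφ.tendsto_atTop))
  refine ⟨hs'.mem, hs'.A_mem, ?_⟩
  have := hs'.le u hs.mem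
  rwa [Submodule.inner_left_of_mem_orthogonal hs.A_mem hs'.g_mem, add_zero] at this

end ADMMRun

end ADMM

/-! ### Minimization over a subspace and over a product -/

section Auxiliary

/-- Stationarity characterizes minimizers over a subspace of a linear plus quadratic penalty. -/
theorem isMinOn_penalty_iff {H : Type*} [NormedAddCommGroup H] [InnerProductSpace ℝ H]
    [FiniteDimensional ℝ H] (K : Submodule ℝ H) {κ : ℝ} (hκ : 0 < κ) (c : ℝ) (g a : H) {w : H}
    (hw : w ∈ K) :
    IsMinOn (fun w => c + ⟪g, a - w⟫_ℝ + κ / 2 * ‖a - w‖ ^ 2) K w ↔ g + κ • (a - w) ∈ Kᗮ := by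
  have expand : ∀ u, c + ⟪g, a - (w + u)⟫_ℝ + κ / 2 * ‖a - (w + u)‖ ^ 2
      = c + ⟪g, a - w⟫_ℝ + κ / 2 * ‖a - w‖ ^ 2 - ⟪g + κ • (a - w), u⟫_ℝ + κ / 2 * ‖u‖ ^ 2 := by
    intro u
    rw [← sub_sub, inner_sub_right, norm_sub_sq_real (a - w) u, inner_add_left,
      real_inner_smul_left]
    ring
  constructor
  · intro h
    set p := K.starProjection (g + κ • (a - w))
    have hp : p ∈ K := K.starProjection_apply_mem _
    -- Moving along p by t changes the objective by -t ‖p‖² + κ t² ‖p‖² / 2, which is smallest at t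
    -- = κ⁻¹.
    have h1 := isMinOn_iff.1 h (w + κ⁻¹ • p) (K.add_mem hw (K.smul_mem _ hp))
    beta_reduce at h1
    have h2 : ⟪g + κ • (a - w), p⟫_ℝ = ‖p‖ ^ 2 := by
      have h3 : ⟪g + κ • (a - w) - p, p⟫_ℝ = 0 :=
        K.starProjection_inner_eq_zero _ _ hp
      rw [inner_sub_left, real_inner_self_eq_norm_sq] at h3
      linarith
    rw [expand, inner_smul_right, h2, norm_smul, mul_pow, Real.norm_eq_abs, sq_abs] at h1
    have h4 : κ / 2 * (κ⁻¹ ^ 2 * ‖p‖ ^ 2) = κ⁻¹ * ‖p‖ ^ 2 / 2 := by field_simp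
    rw [h4] at h1
    have h5 : κ⁻¹ * ‖p‖ ^ 2 ≤ 0 := by linarith
    have h6 : ‖p‖ ^ 2 ≤ 0 := by
      by_contra hc
      exact absurd h5 (not_le.2 (mul_pos (inv_pos.2 hκ) (not_le.1 hc)))
    have h7 : p = 0 := by
      have : ‖p‖ = 0 := by nlinarith [norm_nonneg p]
      exact norm_eq_zero.1 this
    exact K.starProjection_apply_eq_zero_iff.1 h7
  · intro h
    refine isMinOn_iff.2 fun v hv => ?_
    have h1 := expand (v - w)
    rw [add_sub_cancel, Submodule.inner_left_of_mem_orthogonal (K.sub_mem hv hw) h] at h1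
    rw [h1]
    have : 0 ≤ κ / 2 * ‖v - w‖ ^ 2 := by positivity
    linarith

/-- A separable function is minimized over a product by minimizing each summand. -/
theorem isMinOn_sum_iff {ι : Type*} [Fintype ι] {X : ι → Type*} {S : ∀ i, Set (X i)}
    {ψ : ∀ i, X i → ℝ} {x : ∀ i, X i} (hx : ∀ i, x i ∈ S i) :
    IsMinOn (fun u : ∀ i, X i => ∑ i, ψ i (u i)) {u | ∀ i, u i ∈ S i} x ↔
      ∀ i, IsMinOn (ψ i) (S i) (x i) := by
  constructor
  · intro h i
    refine isMinOn_iff.2 fun y hy => ?_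
    have h1 := isMinOn_iff.1 h (Function.update x i y) (fun k => by
      by_cases hk : k = i
      · subst hk; simpa using hy
      · simpa [hk] using hx k)
    beta_reduce at h1
    rw [← Finset.add_sum_erase _ _ (Finset.mem_univ i),
      ← Finset.add_sum_erase Finset.univ (fun k => ψ k (Function.update x i y k))
        (Finset.mem_univ i)] at h1
    have h2 : ∑ k ∈ Finset.univ.erase i, ψ k (Function.update x i y k)
        = ∑ k ∈ Finset.univ.erase i, ψ k (x k) :=
      Finset.sum_congr rfl fun k hk => by rw [Function.update_of_ne (Finset.ne_of_mem_erase hk)]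
    rw [h2, Function.update_self] at h1
    linarith
  · intro h
    exact isMinOn_iff.2 fun u hu => Finset.sum_le_sum fun i _ => isMinOn_iff.1 (h i) _ (hu i)

end Auxiliary

/-! ### The penalty inequality and the Euclidean space of shared blocks -/

namespace PartitionedMicrogrid

/-- Schur complement with respect to the identity block, which leaves the scalar α - ‖r‖². -/
theorem penaltyLMI_iff {ι : Type} [Fintype ι] (α : ℝ) (r : ι → ℝ) :
    PenaltyLMI α r ↔ ∑ k, r k ^ 2 ≤ α := by
  have hB : (of fun (k : ι) (_ : Unit) => -r k) = (of fun (_ : Unit) (k : ι) => -r k)ᴴ := by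
    ext; simp
  have h1 : -(fromBlocks (of fun _ _ : Unit => -α) (of fun (_ : Unit) k => r k)
      (of fun k (_ : Unit) => r k) (-1 : Matrix ι ι ℝ))
      = fromBlocks (of fun _ _ : Unit => α) (of fun (_ : Unit) (k : ι) => -r k)
        (of fun (_ : Unit) (k : ι) => -r k)ᴴ (1 : Matrix ι ι ℝ) := by
    rw [← hB, fromBlocks_neg]
    congr 1
    · ext; simp
    · simp
  have : Invertible (1 : Matrix ι ι ℝ) := invertibleOne
  unfold PenaltyLMI
  rw [h1, PosDef.fromBlocks₂₂ _ _ (PosDef.one (n := ι) (R := ℝ))]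
  have h2 : (of fun _ _ : Unit => α) - (of fun (_ : Unit) (k : ι) => -r k) * (1 : Matrix ι ι ℝ)⁻¹ *
      (of fun (_ : Unit) (k : ι) => -r k)ᴴ = diagonal fun _ => α - ∑ k, r k ^ 2 := by
    ext i j
    simp [Matrix.mul_apply, sq]
  rw [h2, posSemidef_diagonal_iff]
  simp

variable {N L : ℕ} (D : PartitionedMicrogrid N L)

theorem mem_nbr_symm {l j : Fin L} (h : j ∈ D.nbr l) : l ∈ D.nbr j := by
  simp only [nbr, SimpleGraph.mem_neighborFinset] at h ⊢
  exact h.symm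

/-- Positions of the coupling constraints: an entry of the shared block of a neighboring pair. -/
abbrev PairEntry : Type :=
  (l : Fin L) × (j : {j // j ∈ D.nbr l}) × (D.SharedIdx l j × D.SharedIdx l j)

/-- The Euclidean space of real and imaginary parts of families of shared blocks. -/
abbrev CouplingSpace : Type := EuclideanSpace ℝ (D.PairEntry ⊕ D.PairEntry)

/-- The vector of the entries of two families of real matrices at neighboring pairs. -/
def coupVec (P Q : D.PairMat) : D.CouplingSpace :=
  WithLp.toLp 2 (Sum.elim (fun k => P k.1 k.2.1 k.2.2.1 k.2.2.2) (fun k => Q k.1 k.2.1 k.2.2.1 k.2.2.2))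

@[simp] theorem coupVec_inl (P Q : D.PairMat) (k : D.PairEntry) :
    D.coupVec P Q (Sum.inl k) = P k.1 k.2.1 k.2.2.1 k.2.2.2 := rfl

@[simp] theorem coupVec_inr (P Q : D.PairMat) (k : D.PairEntry) :
    D.coupVec P Q (Sum.inr k) = Q k.1 k.2.1 k.2.2.1 k.2.2.2 := rfl

/-- The same position seen from the other area of the pair. -/
def swapEntry (k : D.PairEntry) : D.PairEntry :=
  ⟨k.2.1, ⟨k.1, D.mem_nbr_symm k.2.1.2⟩,
    ⟨k.2.2.1.1, k.2.2.1.2.symm⟩, ⟨k.2.2.2.1, k.2.2.2.2.symm⟩⟩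

theorem swapEntry_swapEntry (k : D.PairEntry) : D.swapEntry (D.swapEntry k) = k := rfl

def swapEquiv : D.PairEntry ≃ D.PairEntry :=
  ⟨D.swapEntry, D.swapEntry, D.swapEntry_swapEntry, D.swapEntry_swapEntry⟩

theorem coupVec_eq_iff {P Q P' Q' : D.PairMat} :
    D.coupVec P Q = D.coupVec P' Q' ↔ ∀ l, ∀ j ∈ D.nbr l, P l j = P' l j ∧ Q l j = Q' l j := by
  constructor
  · intro h l j hj
    constructor
    · ext a b
      exact congrArg (fun v : D.CouplingSpace => v (Sum.inl ⟨l, ⟨j, hj⟩, a, b⟩)) h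
    · ext a b
      exact congrArg (fun v : D.CouplingSpace => v (Sum.inr ⟨l, ⟨j, hj⟩, a, b⟩)) h
  · intro h
    ext k
    rcases k with k | k
    · simp [(h k.1 k.2.1 k.2.1.2).1]
    · simp [(h k.1 k.2.1 k.2.1.2).2]

theorem coupVec_surjective (h : D.CouplingSpace) : ∃ P Q : D.PairMat, D.coupVec P Q = h := by
  refine ⟨fun l j => of fun a b => if hj : j ∈ D.nbr l then h (Sum.inl ⟨l, ⟨j, hj⟩, a, b⟩) else 0,
    fun l j => of fun a b => if hj : j ∈ D.nbr l then h (Sum.inr ⟨l, ⟨j, hj⟩, a, b⟩) else 0, ?_⟩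
  ext k
  rcases k with k | k
  · rw [coupVec_inl]; exact dif_pos k.2.1.2
  · rw [coupVec_inr]; exact dif_pos k.2.1.2

/-- The linear map sending local matrices to their shared blocks. -/
def coupMap : (∀ l, D.AreaMat l) →ₗ[ℝ] D.CouplingSpace where
  toFun V := D.coupVec (fun l j => (D.block l j (V l)).map Complex.re)
    (fun l j => (D.block l j (V l)).map Complex.im)
  map_add' U V := by
    ext k; rcases k with k | k <;> simp [block]
  map_smul' c V := by
    ext k; rcases k with k | k <;> simp [block]

theorem coupMap_apply (V : ∀ l, D.AreaMat l) :
    D.coupMap V = D.coupVec (fun l j => (D.block l j (V l)).map Complex.re)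
    (fun l j => (D.block l j (V l)).map Complex.im) := rfl

/-- The subspace of families that agree on both orientations of each neighboring pair. -/
def consensusSpace : Submodule ℝ D.CouplingSpace where
  carrier := {h | ∀ k, h (Sum.inl (D.swapEntry k)) = h (Sum.inl k) ∧
    h (Sum.inr (D.swapEntry k)) = h (Sum.inr k)}
  add_mem' ha hb k := by simp [(ha k).1, (ha k).2, (hb k).1, (hb k).2]
  zero_mem' k := by simp
  smul_mem' c a ha k := by simp [(ha k).1, (ha k).2]

theorem coupVec_mem_consensusSpace {W X : D.PairMat} :
    D.coupVec W X ∈ D.consensusSpace ↔ D.Consensus W ∧ D.Consensus X := by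
  constructor
  · intro h
    constructor
    · intro l j hj
      ext a b
      exact (h ⟨l, ⟨j, hj⟩, a, b⟩).1
    · intro l j hj
      ext a b
      exact (h ⟨l, ⟨j, hj⟩, a, b⟩).2
  · rintro ⟨hW, hX⟩ k
    exact ⟨congrFun (congrFun (hW k.1 k.2.1 k.2.1.2) k.2.2.1) k.2.2.2,
      congrFun (congrFun (hX k.1 k.2.1 k.2.1.2) k.2.2.1) k.2.2.2⟩

/-- A vector antisymmetric under the swap is orthogonal to every symmetric one: reindexing the inner
product by the swap changes its sign. -/
theorem mem_consensusSpace_orthogonal {h : D.CouplingSpace}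
    (hh : ∀ k, h (Sum.inl (D.swapEntry k)) = -h (Sum.inl k) ∧
      h (Sum.inr (D.swapEntry k)) = -h (Sum.inr k)) : h ∈ D.consensusSpaceᗮ := by
  rw [Submodule.mem_orthogonal]
  intro u hu
  have h1 : ∑ k, ⟪u (Sum.inl k), h (Sum.inl k)⟫_ℝ = 0 := by
    have := Equiv.sum_comp D.swapEquiv fun k => ⟪u (Sum.inl k), h (Sum.inl k)⟫_ℝ
    have h2 : ∀ k, ⟪u (Sum.inl (D.swapEquiv k)), h (Sum.inl (D.swapEquiv k))⟫_ℝ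
        = -⟪u (Sum.inl k), h (Sum.inl k)⟫_ℝ := fun k => by
      change ⟪u (Sum.inl (D.swapEntry k)), h (Sum.inl (D.swapEntry k))⟫_ℝ = _
      rw [(hu k).1, (hh k).1, inner_neg_right]
    simp only [h2, Finset.sum_neg_distrib] at this
    linarith
  have h1' : ∑ k, ⟪u (Sum.inr k), h (Sum.inr k)⟫_ℝ = 0 := by
    have := Equiv.sum_comp D.swapEquiv fun k => ⟪u (Sum.inr k), h (Sum.inr k)⟫_ℝ
    have h2 : ∀ k, ⟪u (Sum.inr (D.swapEquiv k)), h (Sum.inr (D.swapEquiv k))⟫_ℝ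
        = -⟪u (Sum.inr k), h (Sum.inr k)⟫_ℝ := fun k => by
      change ⟪u (Sum.inr (D.swapEntry k)), h (Sum.inr (D.swapEntry k))⟫_ℝ = _
      rw [(hu k).2, (hh k).2, inner_neg_right]
    simp only [h2, Finset.sum_neg_distrib] at this
    linarith
  rw [PiLp.inner_apply, Fintype.sum_sum_type, h1, h1', add_zero]

/-- The averages of the shared blocks, as a vector. -/
def avgVec (V : ∀ l, D.AreaMat l) : D.CouplingSpace :=
  D.coupVec (fun l j => (D.avg V l j).map Complex.re) (fun l j => (D.avg V l j).map Complex.im)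

theorem avgVec_mem (V : ∀ l, D.AreaMat l) : D.avgVec V ∈ D.consensusSpace := by
  intro k
  constructor
  · change (D.avg V k.2.1 k.1 _ _).re = (D.avg V k.1 k.2.1 _ _).re
    congr 1
    exact congrArg ((1 / 2 : ℂ) * ·) (add_comm _ _)
  · change (D.avg V k.2.1 k.1 _ _).im = (D.avg V k.1 k.2.1 _ _).im
    congr 1
    exact congrArg ((1 / 2 : ℂ) * ·) (add_comm _ _)

theorem half_mul_re (z : ℂ) : ((1 / 2 : ℂ) * z).re = z.re / 2 := by
  have : (1 / 2 : ℂ) = ((1 / 2 : ℝ) : ℂ) := by push_cast; rfl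
  rw [this, Complex.re_ofReal_mul]; ring

theorem half_mul_im (z : ℂ) : ((1 / 2 : ℂ) * z).im = z.im / 2 := by
  have : (1 / 2 : ℂ) = ((1 / 2 : ℝ) : ℂ) := by push_cast; rfl
  rw [this, Complex.im_ofReal_mul]; ring

theorem avg_re (V : ∀ l, D.AreaMat l) (l j : Fin L) : (D.avg V l j).map Complex.re =
    (1 / 2 : ℝ) • ((D.block l j (V l)).map Complex.re
      + (D.flip (D.block j l (V j))).map Complex.re) := by
  ext a b
  change ((1 / 2 : ℂ) * (D.block l j (V l) a b + D.flip (D.block j l (V j)) a b)).re = _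
  rw [half_mul_re]
  simp
  ring

theorem avg_im (V : ∀ l, D.AreaMat l) (l j : Fin L) : (D.avg V l j).map Complex.im =
    (1 / 2 : ℝ) • ((D.block l j (V l)).map Complex.im
      + (D.flip (D.block j l (V j))).map Complex.im) := by
  ext a b
  change ((1 / 2 : ℂ) * (D.block l j (V l) a b + D.flip (D.block j l (V j)) a b)).im = _
  rw [half_mul_im]
  simp
  ring

/-- Half the difference of the two copies is antisymmetric. With `avgVec_mem` this identifies
averaging with the orthogonal projection onto the consensus space. -/
theorem coupMap_sub_avgVec_mem (V : ∀ l, D.AreaMat l) :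
    D.coupMap V - D.avgVec V ∈ D.consensusSpaceᗮ := by
  refine D.mem_consensusSpace_orthogonal fun k => ?_
  simp only [PiLp.sub_apply, coupMap_apply, avgVec, coupVec_inl, coupVec_inr, avg_re, avg_im]
  have e : ∀ x y : ℝ, x - 1 / 2 * (x + y) = -(y - 1 / 2 * (y + x)) := fun x y => by ring
  let x := V k.2.1 ⟨k.2.2.1.1, k.2.2.1.2.2⟩ ⟨k.2.2.2.1, k.2.2.2.2.2⟩
  let y := V k.1 ⟨k.2.2.1.1, k.2.2.1.2.1⟩ ⟨k.2.2.2.1, k.2.2.2.2.1⟩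
  exact ⟨e x.re y.re, e x.im y.im⟩

theorem eq_avgVec_of_sub_mem {V : ∀ l, D.AreaMat l} {w : D.CouplingSpace}
    (hw : w ∈ D.consensusSpace) (h : D.coupMap V - w ∈ D.consensusSpaceᗮ) : w = D.avgVec V := by
  have h1 : w - D.avgVec V ∈ D.consensusSpace := D.consensusSpace.sub_mem hw (D.avgVec_mem V)
  have h2 : w - D.avgVec V ∈ D.consensusSpaceᗮ := by
    have := D.consensusSpaceᗮ.sub_mem (D.coupMap_sub_avgVec_mem V) h
    rwa [sub_sub_sub_cancel_left] at this
  have h3 := Submodule.inner_right_of_mem_orthogonal h1 h2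
  exact sub_eq_zero.1 (inner_self_eq_zero.1 h3)

theorem sum_pairEntry (F : ∀ l j, D.SharedIdx l j → D.SharedIdx l j → ℝ) :
    ∑ k : D.PairEntry, F k.1 k.2.1 k.2.2.1 k.2.2.2
      = ∑ l, ∑ j ∈ D.nbr l, ∑ a, ∑ b, F l j a b := by
  rw [Fintype.sum_sigma]
  refine Finset.sum_congr rfl fun l _ => ?_
  rw [Fintype.sum_sigma, ← Finset.sum_coe_sort (D.nbr l) fun j => ∑ a, ∑ b, F l j a b]
  refine Finset.sum_congr rfl fun j _ => ?_
  rw [Fintype.sum_prod_type]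

theorem trace_transpose_mul {ι : Type} [Fintype ι] (M M' : Matrix ι ι ℝ) :
    (Mᵀ * M').trace = ∑ a, ∑ b, M a b * M' a b := by
  simp only [Matrix.trace, Matrix.diag_apply, Matrix.mul_apply, Matrix.transpose_apply]
  exact Finset.sum_comm

theorem inner_coupVec (P Q P' Q' : D.PairMat) : ⟪D.coupVec P Q, D.coupVec P' Q'⟫_ℝ
    = ∑ l, ∑ j ∈ D.nbr l, (((P l j)ᵀ * P' l j).trace + ((Q l j)ᵀ * Q' l j).trace) := by
  rw [PiLp.inner_apply, Fintype.sum_sum_type]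
  simp only [coupVec_inl, coupVec_inr, trace_transpose_mul, Finset.sum_add_distrib]
  rw [← D.sum_pairEntry fun l j a b => P l j a b * P' l j a b,
    ← D.sum_pairEntry fun l j a b => Q l j a b * Q' l j a b]
  simp only [RCLike.inner_apply, conj_trivial, mul_comm]

theorem norm_sq_coupVec (P Q : D.PairMat) : ‖D.coupVec P Q‖ ^ 2
    = ∑ l, ∑ j ∈ D.nbr l, (frobSq (P l j) + frobSq (Q l j)) := by
  rw [← real_inner_self_eq_norm_sq, inner_coupVec]
  simp only [trace_transpose_mul, frobSq, sq]

theorem coupVec_sub (P Q P' Q' : D.PairMat) :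
    D.coupVec P Q - D.coupVec P' Q' = D.coupVec (P - P') (Q - Q') := by
  ext k; rcases k with k | k <;> simp

theorem coupVec_add (P Q P' Q' : D.PairMat) :
    D.coupVec P Q + D.coupVec P' Q' = D.coupVec (P + P') (Q + Q') := by
  ext k; rcases k with k | k <;> simp

theorem coupVec_smul (c : ℝ) (P Q : D.PairMat) :
    c • D.coupVec P Q = D.coupVec (c • P) (c • Q) := by
  ext k; rcases k with k | k <;> simp

/-! ### The Lagrangian and the update steps in terms of coupling vectors -/

theorem lagrangian_eq (C : ∀ l, D.AreaMat l → ℝ) (κ : ℝ) (V : ∀ l, D.AreaMat l)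
    {W X : D.PairMat} (Γ Λ : D.PairMat) (hW : D.Consensus W) (hX : D.Consensus X) :
    D.lagrangian C κ V W X Γ Λ = ∑ l, C l (V l)
      + ⟪D.coupVec Γ Λ, D.coupMap V - D.coupVec W X⟫_ℝ
      + κ / 2 * ‖D.coupMap V - D.coupVec W X‖ ^ 2 := by
  rw [coupMap_apply, coupVec_sub, norm_sq_coupVec, inner_coupVec, Finset.mul_sum,
    ← Finset.sum_add_distrib, ← Finset.sum_add_distrib]
  refine Finset.sum_congr rfl fun l _ => ?_
  rw [add_assoc, Finset.mul_sum, ← Finset.sum_add_distrib]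
  congr 1
  refine Finset.sum_congr rfl fun j hj => ?_
  rw [hW l j hj, hX l j hj]
  simp only [Pi.sub_apply]
  ring

/-- The local objective with the penalty bounds eliminated. -/
def localPenalty (C : ∀ l, D.AreaMat l → ℝ) (κ : ℝ) (Vi : ∀ l, D.AreaMat l) (Γ Λ : D.PairMat)
    (l : Fin L) (U : D.AreaMat l) : ℝ :=
  D.localLagrangian C κ Γ Λ l (U, fun j => ∑ k, (D.resid Vi l j U k).re ^ 2,
    fun j => ∑ k, (D.resid Vi l j U k).im ^ 2)

theorem frobSq_eq_sum_prod {ι : Type} [Fintype ι] (M : Matrix ι ι ℝ) :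
    frobSq M = ∑ k : ι × ι, M k.1 k.2 ^ 2 := 
  (Fintype.sum_prod_type fun k : ι × ι => M k.1 k.2 ^ 2).symm

theorem sum_localPenalty (C : ∀ l, D.AreaMat l → ℝ) (κ : ℝ) (Vi : ∀ l, D.AreaMat l)
    (Γ Λ : D.PairMat) (V : ∀ l, D.AreaMat l) :
    ∑ l, D.localPenalty C κ Vi Γ Λ l (V l) = ∑ l, C l (V l)
      + ⟪D.coupVec Γ Λ, D.coupMap V⟫_ℝ + κ / 2 * ‖D.coupMap V - D.avgVec Vi‖ ^ 2 := by
  have hpen : κ / 2 * ‖D.coupMap V - D.avgVec Vi‖ ^ 2 = ∑ l, ∑ j ∈ D.nbr l, κ / 2 *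
      (∑ k, (D.resid Vi l j (V l) k).re ^ 2 + ∑ k, (D.resid Vi l j (V l) k).im ^ 2) := by
    rw [coupMap_apply, avgVec, coupVec_sub, norm_sq_coupVec, Finset.mul_sum]
    refine Finset.sum_congr rfl fun l _ => ?_
    rw [Finset.mul_sum]
    refine Finset.sum_congr rfl fun j _ => ?_
    rw [frobSq_eq_sum_prod, frobSq_eq_sum_prod]
    simp only [resid, Matrix.sub_apply, Complex.sub_re, Complex.sub_im, Pi.sub_apply, Matrix.map_apply]
  have hin : ⟪D.coupVec Γ Λ, D.coupMap V⟫_ℝ = ∑ l, ∑ j ∈ D.nbr l,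
      (((Γ l j)ᵀ * (D.block l j (V l)).map Complex.re).trace
        + ((Λ l j)ᵀ * (D.block l j (V l)).map Complex.im).trace) := by
    rw [coupMap_apply, inner_coupVec]
  rw [hpen, hin, ← Finset.sum_add_distrib, ← Finset.sum_add_distrib]
  exact Finset.sum_congr rfl fun l _ => add_right_comm _ _ _

/-- Epigraph elimination: α and β enter the objective with positive weight κ/2 and are bounded below
by the squared residuals, so those squares are their best values. -/
theorem isMinOn_localPenalty_iff (C : ∀ l, D.AreaMat l → ℝ) {κ : ℝ} (hκ : 0 < κ)
    (Vi : ∀ l, D.AreaMat l) (Γ Λ : D.PairMat) (l : Fin L) (U : D.AreaMat l) :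
    (∃ α β : Fin L → ℝ, (U, α, β) ∈ D.localFeasible Vi l ∧
      IsMinOn (D.localLagrangian C κ Γ Λ l) (D.localFeasible Vi l) (U, α, β)) ↔
    U ∈ D.localSet l ∧ IsMinOn (D.localPenalty C κ Vi Γ Λ l) (D.localSet l) U := by
  have hmem : ∀ {U' : D.AreaMat l}, U' ∈ D.localSet l →
      (U', (fun j => ∑ k, (D.resid Vi l j U' k).re ^ 2),
        fun j => ∑ k, (D.resid Vi l j U' k).im ^ 2) ∈ D.localFeasible Vi l := fun hU' =>
    ⟨hU', fun j _ => ⟨Finset.sum_nonneg fun _ _ => sq_nonneg _,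
      Finset.sum_nonneg fun _ _ => sq_nonneg _, (penaltyLMI_iff _ _).2 le_rfl,
      (penaltyLMI_iff _ _).2 le_rfl⟩⟩
  have hle : ∀ p ∈ D.localFeasible Vi l,
      D.localPenalty C κ Vi Γ Λ l p.1 ≤ D.localLagrangian C κ Γ Λ l p := by
    intro p hp
    simp only [localPenalty, localLagrangian]
    gcongr with j hj
    · exact (penaltyLMI_iff _ _).1 (hp.2 j hj).2.2.1
    · exact (penaltyLMI_iff _ _).1 (hp.2 j hj).2.2.2
  constructor
  · rintro ⟨α, β, hf, hmin⟩
    exact ⟨hf.1, isMinOn_iff.2 fun U' hU' =>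
      (hle _ hf).trans (isMinOn_iff.1 hmin _ (hmem hU'))⟩
  · rintro ⟨hU, hmin⟩
    exact ⟨_, _, hmem hU, isMinOn_iff.2 fun p hp =>
      (isMinOn_iff.1 hmin p.1 hp.1).trans (hle p hp)⟩

theorem primalStep_iff (C : ∀ l, D.AreaMat l → ℝ) {κ : ℝ} (hκ : 0 < κ)
    (Vi Vnext : ∀ l, D.AreaMat l) (Γ Λ : D.PairMat) :
    D.PrimalStep C κ Vi Vnext Γ Λ ↔ (∀ l, Vnext l ∈ D.localSet l) ∧
      IsMinOn (fun V : ∀ l, D.AreaMat l => ∑ l, C l (V l) + ⟪D.coupVec Γ Λ, D.coupMap V⟫_ℝ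
        + κ / 2 * ‖D.coupMap V - D.avgVec Vi‖ ^ 2) {V | ∀ l, V l ∈ D.localSet l} Vnext := by
  simp only [PrimalStep, D.isMinOn_localPenalty_iff C hκ, forall_and]
  refine and_congr_right fun h => ?_
  simp only [← isMinOn_sum_iff h, sum_localPenalty]

theorem dualStep_iff (κ : ℝ) (Vnext : ∀ l, D.AreaMat l) (Γ Λ Γnext Λnext : D.PairMat) :
    D.DualStep κ Vnext Γ Λ Γnext Λnext ↔ D.coupVec Γnext Λnext
      = D.coupVec Γ Λ + κ • (D.coupMap Vnext - D.avgVec Vnext) := by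
  rw [coupMap_apply, avgVec, coupVec_sub, coupVec_smul, coupVec_add, coupVec_eq_iff]
  refine forall_congr' fun l => forall_congr' fun j => imp_congr_right fun hj => ?_
  simp only [Pi.add_apply, Pi.smul_apply, Pi.sub_apply, avg_re, avg_im]
  have e : ∀ x y : Matrix (D.SharedIdx l j) (D.SharedIdx l j) ℝ,
      (κ / 2) • (x - y) = κ • (x - (1 / 2 : ℝ) • (x + y)) := fun x y => by module
  rw [e, e]

theorem coupVec_eq_zero {Γ Λ : D.PairMat} (hΓ : D.ZeroMult Γ) (hΛ : D.ZeroMult Λ) :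
    D.coupVec Γ Λ = 0 := by
  ext k
  rcases k with k | k
  · simp [hΓ k.1 k.2.1 k.2.1.2]
  · simp [hΛ k.1 k.2.1 k.2.1.2]

/-- The two objectives differ by the pairing of the multiplier with W, X, which does not depend on
the local matrices. -/
theorem isMinOn_lagrangian_iff (C : ∀ l, D.AreaMat l → ℝ) (κ : ℝ) {W X : D.PairMat}
    (hW : D.Consensus W) (hX : D.Consensus X) (Γ Λ : D.PairMat) (S : Set (∀ l, D.AreaMat l))
    (V : ∀ l, D.AreaMat l) :
    IsMinOn (fun U => D.lagrangian C κ U W X Γ Λ) S V ↔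
      IsMinOn (fun V : ∀ l, D.AreaMat l => ∑ l, C l (V l) + ⟪D.coupVec Γ Λ, D.coupMap V⟫_ℝ
        + κ / 2 * ‖D.coupMap V - D.coupVec W X‖ ^ 2) S V := by
  simp only [isMinOn_iff, D.lagrangian_eq C κ _ Γ Λ hW hX, inner_sub_right]
  refine forall_congr' fun U => imp_congr_right fun _ => ?_
  constructor <;> intro h <;> linarith

theorem isMinOn_lagrangian_consensus_iff (C : ∀ l, D.AreaMat l → ℝ) {κ : ℝ} (hκ : 0 < κ)
    (V : ∀ l, D.AreaMat l) (Γ Λ : D.PairMat) {W X : D.PairMat}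
    (hW : D.Consensus W) (hX : D.Consensus X) :
    IsMinOn (fun p : D.PairMat × D.PairMat => D.lagrangian C κ V p.1 p.2 Γ Λ)
      {p | D.Consensus p.1 ∧ D.Consensus p.2} (W, X) ↔
    D.coupVec Γ Λ + κ • (D.coupMap V - D.coupVec W X) ∈ D.consensusSpaceᗮ := by
  rw [← isMinOn_penalty_iff D.consensusSpace hκ (∑ l, C l (V l)) _ _
    (D.coupVec_mem_consensusSpace.2 ⟨hW, hX⟩)]
  simp only [isMinOn_iff]
  constructor
  · intro h u hu
    obtain ⟨P, Q, rfl⟩ := D.coupVec_surjective u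
    have hPQ := D.coupVec_mem_consensusSpace.1 hu
    have := h (P, Q) hPQ
    rwa [D.lagrangian_eq C κ V Γ Λ hW hX, D.lagrangian_eq C κ V Γ Λ hPQ.1 hPQ.2] at this
  · rintro h ⟨P, Q⟩ hPQ
    rw [D.lagrangian_eq C κ V Γ Λ hW hX, D.lagrangian_eq C κ V Γ Λ hPQ.1 hPQ.2]
    exact h _ (D.coupVec_mem_consensusSpace.2 hPQ)

theorem consensus_avg (V : ∀ l, D.AreaMat l) :
    D.Consensus (fun l j => (D.avg V l j).map Complex.re) ∧
      D.Consensus (fun l j => (D.avg V l j).map Complex.im) :=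
  D.coupVec_mem_consensusSpace.1 (D.avgVec_mem V)

/-- The multiplier update at the level of coupling vectors. -/
theorem multiplier_update_iff (κ : ℝ) (V : ∀ l, D.AreaMat l) {W X : D.PairMat}
    (hW : D.Consensus W) (hX : D.Consensus X) (Γ Λ Γ' Λ' : D.PairMat) :
    ((∀ l, ∀ j ∈ D.nbr l, Γ' l j =
        Γ l j + κ • ((D.block l j (V l)).map Complex.re - D.flip (W j l))) ∧
      (∀ l, ∀ j ∈ D.nbr l, Λ' l j =
        Λ l j + κ • ((D.block l j (V l)).map Complex.im - D.flip (X j l)))) ↔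
    D.coupVec Γ' Λ' = D.coupVec Γ Λ + κ • (D.coupMap V - D.coupVec W X) := by
  rw [coupMap_apply, coupVec_sub, coupVec_smul, coupVec_add, coupVec_eq_iff, ← forall_and]
  refine forall_congr' fun l => ?_
  rw [← forall_and]
  refine forall_congr' fun j => ?_
  rw [← imp_and]
  refine imp_congr_right fun hj => ?_
  rw [hW l j hj, hX l j hj]
  rfl

/-! ### Equivalence of ADMM runs and runs of the local updates -/

section Runs

variable {D} {C : ∀ l, D.AreaMat l → ℝ} {κ : ℝ} {V : ℕ → ∀ l, D.AreaMat l}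
  {W X Γ Λ : ℕ → D.PairMat}

theorem IsADMM.coupVec_succ (h : D.IsADMM C κ V W X Γ Λ) (i : ℕ) :
    D.coupVec (Γ (i + 1)) (Λ (i + 1)) = D.coupVec (Γ i) (Λ i)
      + κ • (D.coupMap (V (i + 1)) - D.coupVec (W (i + 1)) (X (i + 1))) :=
  (D.multiplier_update_iff κ (V (i + 1)) (h.S2_mem i).1 (h.S2_mem i).2 _ _ _ _).1
    ⟨h.S3_re i, h.S3_im i⟩

/-- The stationary vector of [S2] is the multiplier set by [S3]; the zero initialization is needed
only at index 0. -/
theorem IsADMM.multiplier_mem (h : D.IsADMM C κ V W X Γ Λ) (hκ : 0 < κ)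
    (hΓ : D.ZeroMult (Γ 0)) (hΛ : D.ZeroMult (Λ 0)) :
    ∀ i, D.coupVec (Γ i) (Λ i) ∈ D.consensusSpaceᗮ
  | 0 => by rw [D.coupVec_eq_zero hΓ hΛ]; exact Submodule.zero_mem _
  | i + 1 => by
    rw [h.coupVec_succ i]
    exact (D.isMinOn_lagrangian_consensus_iff C hκ _ _ _ (h.S2_mem i).1 (h.S2_mem i).2).1
      (h.S2_min i)

/-- Consecutive multipliers lie in Kᗮ, hence so does the residual, which characterizes the
projection onto K. Nothing is claimed at index 0, where W and X are free. -/
theorem IsADMM.coupVec_eq_avgVec (h : D.IsADMM C κ V W X Γ Λ) (hκ : 0 < κ)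
    (hΓ : D.ZeroMult (Γ 0)) (hΛ : D.ZeroMult (Λ 0)) (i : ℕ) :
    D.coupVec (W (i + 1)) (X (i + 1)) = D.avgVec (V (i + 1)) := by
  refine D.eq_avgVec_of_sub_mem (D.coupVec_mem_consensusSpace.2 (h.S2_mem i)) ?_
  have h1 := D.consensusSpaceᗮ.sub_mem (h.multiplier_mem hκ hΓ hΛ (i + 1))
    (h.multiplier_mem hκ hΓ hΛ i)
  rw [h.coupVec_succ i, add_sub_cancel_left] at h1
  have h2 := D.consensusSpaceᗮ.smul_mem κ⁻¹ h1
  rwa [smul_smul, inv_mul_cancel₀ hκ.ne', one_smul] at h2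

theorem IsADMM.dualStep (h : D.IsADMM C κ V W X Γ Λ) (hκ : 0 < κ)
    (hΓ : D.ZeroMult (Γ 0)) (hΛ : D.ZeroMult (Λ 0)) (i : ℕ) :
    D.DualStep κ (V (i + 1)) (Γ i) (Λ i) (Γ (i + 1)) (Λ (i + 1)) := by
  rw [dualStep_iff, ← h.coupVec_eq_avgVec hκ hΓ hΛ i]
  exact h.coupVec_succ i

theorem IsADMM.primalStep_of_eq (h : D.IsADMM C κ V W X Γ Λ) (hκ : 0 < κ) (i : ℕ)
    (hi : D.coupVec (W i) (X i) = D.avgVec (V i)) :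
    D.PrimalStep C κ (V i) (V (i + 1)) (Γ i) (Λ i) := by
  have hWX := D.coupVec_mem_consensusSpace.1 (hi ▸ D.avgVec_mem (V i))
  rw [D.primalStep_iff C hκ]
  refine ⟨h.S1_mem i, ?_⟩
  rw [← hi, ← D.isMinOn_lagrangian_iff C κ hWX.1 hWX.2]
  exact h.S1_min i

theorem multiplier_mem_of_dualStep
    (hD : ∀ i, D.DualStep κ (V (i + 1)) (Γ i) (Λ i) (Γ (i + 1)) (Λ (i + 1)))
    (hΓ : D.ZeroMult (Γ 0)) (hΛ : D.ZeroMult (Λ 0)) :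
    ∀ i, D.coupVec (Γ i) (Λ i) ∈ D.consensusSpaceᗮ
  | 0 => by rw [D.coupVec_eq_zero hΓ hΛ]; exact Submodule.zero_mem _
  | i + 1 => by
    rw [(D.dualStep_iff _ _ _ _ _ _).1 (hD i)]
    exact Submodule.add_mem _ (multiplier_mem_of_dualStep hD hΓ hΛ i)
      (Submodule.smul_mem _ _ (D.coupMap_sub_avgVec_mem _))

theorem isADMM_of_steps (hκ : 0 < κ)
    (hP : ∀ i, D.PrimalStep C κ (V i) (V (i + 1)) (Γ i) (Λ i))
    (hD : ∀ i, D.DualStep κ (V (i + 1)) (Γ i) (Λ i) (Γ (i + 1)) (Λ (i + 1)))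
    (hΓ : D.ZeroMult (Γ 0)) (hΛ : D.ZeroMult (Λ 0)) :
    D.IsADMM C κ V (fun i l j => (D.avg (V i) l j).map Complex.re)
      (fun i l j => (D.avg (V i) l j).map Complex.im) Γ Λ := by
  have hS3 := fun i => (D.multiplier_update_iff κ (V (i + 1)) (D.consensus_avg (V (i + 1))).1
    (D.consensus_avg (V (i + 1))).2 (Γ i) (Λ i) (Γ (i + 1)) (Λ (i + 1))).2
    ((D.dualStep_iff _ _ _ _ _ _).1 (hD i))
  refine ⟨fun i => ((D.primalStep_iff C hκ _ _ _ _).1 (hP i)).1, fun i => ?_,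
    fun i => D.consensus_avg _, fun i => ?_, fun i => (hS3 i).1, fun i => (hS3 i).2⟩
  · rw [D.isMinOn_lagrangian_iff C κ (D.consensus_avg _).1 (D.consensus_avg _).2]
    exact ((D.primalStep_iff C hκ _ _ _ _).1 (hP i)).2
  · rw [D.isMinOn_lagrangian_consensus_iff C hκ _ _ _ (D.consensus_avg _).1 (D.consensus_avg _).2]
    have := multiplier_mem_of_dualStep hD hΓ hΛ (i + 1)
    rwa [(D.dualStep_iff _ _ _ _ _ _).1 (hD i)] at this

theorem admmRun_of_steps (hκ : 0 < κ)
    (hC : ConvexOn ℝ {V | ∀ l, V l ∈ D.localSet l} fun V : ∀ l, D.AreaMat l => ∑ l, C l (V l))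
    (hP : ∀ i, D.PrimalStep C κ (V i) (V (i + 1)) (Γ i) (Λ i))
    (hD : ∀ i, D.DualStep κ (V (i + 1)) (Γ i) (Λ i) (Γ (i + 1)) (Λ (i + 1)))
    (hΓ : D.ZeroMult (Γ 0)) (hΛ : D.ZeroMult (Λ 0)) :
    ADMMRun {V | ∀ l, V l ∈ D.localSet l} (fun V : ∀ l, D.AreaMat l => ∑ l, C l (V l))
      D.coupMap D.consensusSpace κ V (fun i => D.avgVec (V i))
      (fun i => D.coupVec (Γ i) (Λ i)) where
  mem i := ((D.primalStep_iff C hκ _ _ _ _).1 (hP i)).1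
  opt i y hy := by
    have h := (D.primalStep_iff C hκ _ _ _ _).1 (hP i)
    have h1 := IsMinOn.quadratic_variational hC D.coupMap h.1 h.2 hy
    -- The gradient of the penalty at the new iterate involves the old multiplier and old average;
    -- the dual step rewrites it with the new multiplier, as `ADMMRun` requires.
    have e : D.coupVec (Γ (i + 1)) (Λ (i + 1)) + κ • (D.avgVec (V (i + 1)) - D.avgVec (V i))
        = D.coupVec (Γ i) (Λ i) + κ • (D.coupMap (V (i + 1)) - D.avgVec (V i)) := by
      rw [(D.dualStep_iff _ _ _ _ _ _).1 (hD i)]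
      module
    rwa [e]
  W_mem i := D.avgVec_mem _
  G_mem := multiplier_mem_of_dualStep hD hΓ hΛ
  step i := (D.dualStep_iff _ _ _ _ _ _).1 (hD i)

end Runs

end PartitionedMicrogrid

/-! ### Gram matrices and the positive semidefinite cone -/

section Gram

variable {E : Type*} [NormedAddCommGroup E] [InnerProductSpace ℂ E]

/-- Two families of vectors with the same Gram matrix differ by an isometry. -/
theorem exists_linearIsometry_of_inner_eq [FiniteDimensional ℂ E] {n : Type*} (f g : n → E)
    (h : ∀ i j, ⟪f i, f j⟫_ℂ = ⟪g i, g j⟫_ℂ) : ∃ S : E →ₗᵢ[ℂ] E, ∀ i, S (f i) = g i := by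
  set F := Finsupp.linearCombination ℂ f
  set G := Finsupp.linearCombination ℂ g
  have hin : ∀ c, ⟪F c, F c⟫_ℂ = ⟪G c, G c⟫_ℂ := fun c => by
    simp only [F, G, Finsupp.linearCombination_apply, Finsupp.sum, sum_inner, inner_sum,
      inner_smul_left, inner_smul_right, h]
  have hnorm : ∀ c, ‖F c‖ = ‖G c‖ := fun c => by
    rw [@norm_eq_sqrt_re_inner ℂ, @norm_eq_sqrt_re_inner ℂ, hin]
  obtain ⟨s, hs⟩ := F.rangeRestrict.exists_rightInverse_of_surjective F.range_rangeRestrict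
  have hFs : ∀ v, F (s v) = v := fun v => congrArg Subtype.val (LinearMap.congr_fun hs v)
  -- Equal Gram matrices give ‖F c‖ = ‖G c‖ for all coefficients c, so F c ↦ G c is a well-defined
  -- isometry on the span of f; it then extends to the whole finite-dimensional space.
  let T : LinearMap.range F →ₗᵢ[ℂ] E := ⟨G ∘ₗ s, fun v => by
    rw [LinearMap.comp_apply, ← hnorm, hFs, Submodule.coe_norm]⟩
  refine ⟨T.extend, fun i => ?_⟩
  have hi : F (Finsupp.single i 1) = f i := by simp [F]
  have hmem : f i ∈ LinearMap.range F := ⟨_, hi⟩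
  have h1 : T.extend (f i) = T ⟨f i, hmem⟩ := T.extend_apply ⟨f i, hmem⟩
  have h2 : G (s ⟨f i, hmem⟩ - Finsupp.single i 1) = 0 := by
    rw [← norm_eq_zero, ← hnorm, map_sub, hFs, hi, sub_self, norm_zero]
  rw [h1]
  change G (s ⟨f i, hmem⟩) = g i
  rw [map_sub, sub_eq_zero] at h2
  rw [h2]
  simp [G]

/-- Every positive semidefinite matrix is a Gram matrix, in any Euclidean space with enough
coordinates. -/
theorem Matrix.PosSemidef.exists_inner_eq {n ι : Type*} [Fintype n] [Fintype ι]
    {M : Matrix n n ℂ} (hM : M.PosSemidef) {e : n → ι} (he : Function.Injective e) :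
    ∃ v : n → EuclideanSpace ℂ ι, ∀ x y, ⟪v x, v y⟫_ℂ = M x y := by
  obtain ⟨B, rfl⟩ : ∃ B : Matrix n n ℂ, M = Bᴴ * B := by
    open scoped MatrixOrder in
    exact CStarAlgebra.nonneg_iff_eq_star_mul_self.mp hM.nonneg
  -- The columns of B are padded with zeros along e, so that matrices of different sizes get vectors
  -- in one common space.
  refine ⟨fun x => WithLp.toLp 2 (Function.extend e (fun k => B k x) 0), fun x y => ?_⟩
  rw [PiLp.inner_apply, Matrix.mul_apply]
  symm
  refine Fintype.sum_of_injective e he _ _ (fun i hi => ?_) fun k => ?_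
  · simp only [Function.extend_apply' _ _ _ (by simpa using hi)]
    simp
  · simp only [he.extend_apply]
    simp [mul_comm]

/-- Cauchy–Schwarz for the Gram vectors: the diagonal controls every entry. -/
theorem Matrix.PosSemidef.norm_apply_le {n : Type*} [Fintype n] {M : Matrix n n ℂ}
    (hM : M.PosSemidef) {B : ℝ} (hB : ∀ x, (M x x).re ≤ B) (x y : n) : ‖M x y‖ ≤ B := by
  obtain ⟨v, hv⟩ := hM.exists_inner_eq Function.injective_id
  have h1 : ∀ x, ‖v x‖ ^ 2 ≤ B := fun x => by
    rw [@norm_sq_eq_re_inner ℂ, hv]; exact hB x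
  rw [← hv]
  have h2 := norm_inner_le_norm (𝕜 := ℂ) (v x) (v y)
  nlinarith [h1 x, h1 y, sq_nonneg (‖v x‖ - ‖v y‖)]

instance Matrix.instFirstCountableTopology {m n R : Type*} [Finite m] [Finite n]
    [TopologicalSpace R] [FirstCountableTopology R] : FirstCountableTopology (Matrix m n R) :=
  inferInstanceAs (FirstCountableTopology (m → n → R))

theorem Matrix.isClosed_posSemidef {n : Type*} [Fintype n] :
    IsClosed {M : Matrix n n ℂ | M.PosSemidef} := by
  simp only [Matrix.posSemidef_iff_dotProduct_mulVec, Set.ofPred_and, Set.ofPred_forall]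
  refine IsClosed.inter (isClosed_eq (by fun_prop) continuous_id) (isClosed_iInter fun x => ?_)
  exact isClosed_le continuous_const (by fun_prop)

theorem Matrix.convex_posSemidef {n : Type*} [Fintype n] :
    Convex ℝ {M : Matrix n n ℂ | M.PosSemidef} := by
  intro M hM M' hM' a b ha hb _
  exact (hM.smul ha).add (hM'.smul hb)

end Gram

/-! ### Integration of relations along a tree -/

namespace SimpleGraph

/-- The composition of a step function along a walk. -/
def Walk.foldStep {ι β : Type*} {G : SimpleGraph ι} (step : ι → ι → β → β) (b : β) :
    ∀ {u v : ι}, G.Walk u v → β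
  | _, _, .nil => b
  | _, _, .cons (u := u) (v := v) _ p => step u v (Walk.foldStep step b p)

/-- Local relations between neighbors in a tree can be integrated. -/
theorem IsTree.exists_integral {ι β : Type*} {G : SimpleGraph ι} (hG : G.IsTree) [Nonempty β]
    (R : ι → ι → β → β → Prop) (hsymm : ∀ l j s t, R l j s t → R j l t s)
    (hR : ∀ l j, G.Adj l j → ∀ t, ∃ s, R l j s t) :
    ∃ T : ι → β, ∀ l j, G.Adj l j → R l j (T l) (T j) := by
  have hR' : ∀ l j t, ∃ s, G.Adj l j → R l j s t := fun l j t => by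
    by_cases h : G.Adj l j
    · obtain ⟨s, hs⟩ := hR l j h t
      exact ⟨s, fun _ => hs⟩
    · exact ⟨t, fun h' => absurd h' h⟩
  choose step hstep using hR'
  obtain ⟨r⟩ := hG.connected.nonempty
  -- Root the tree at r; the value at a vertex is obtained by transporting an arbitrary value from r
  -- along its unique path.
  choose P hP hPu using fun l => hG.existsUnique_path l r
  have key : ∀ l j, G.Adj l j → l ∉ (P j).support →
      R l j (Walk.foldStep step (Classical.arbitrary β) (P l))
        (Walk.foldStep step (Classical.arbitrary β) (P j)) := by
    intro l j h hl
    have : P l = Walk.cons h (P j) := (hPu l _ ((hP j).cons hl)).symm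
    rw [this]
    exact hstep l j _ h
  refine ⟨fun l => Walk.foldStep step (Classical.arbitrary β) (P l), fun l j h => ?_⟩
  by_cases hl : l ∈ (P j).support
  · refine hsymm _ _ _ _ (key j l h.symm ?_)
    -- Of two adjacent vertices, exactly one is the parent: if l lies on the path from j to the
    -- root, then j is not on the path from l.
    have := hG.isAcyclic.ne_mem_support_of_support_of_adj_of_isPath (hP j).reverse (hP l).reverse
      h.symm (by simpa using hl)
    simpa using this
  · exact key l j h hl

end SimpleGraph

/-! ### Traces and the supports of the constraint matrices -/

namespace Microgrid

theorem tr_add {ι : Type} [Fintype ι] (Φ V V' : Matrix ι ι ℂ) : tr Φ (V + V') = tr Φ V + tr Φ V' := by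
  simp [tr, Matrix.mul_add]

theorem tr_smul {ι : Type} [Fintype ι] (c : ℝ) (Φ V : Matrix ι ι ℂ) : tr Φ (c • V) = c * tr Φ V := by
  simp [tr]

/-- `V ↦ Re Tr (Φ V)` as a real linear map. -/
def trLin {ι : Type} [Fintype ι] (Φ : Matrix ι ι ℂ) : Matrix ι ι ℂ →ₗ[ℝ] ℝ where
  toFun := tr Φ
  map_add' := tr_add Φ
  map_smul' c V := tr_smul c Φ V

theorem continuous_tr {ι : Type} [Fintype ι] (Φ : Matrix ι ι ℂ) : Continuous (tr Φ) :=
  Complex.continuous_re.comp (Continuous.matrix_trace (continuous_const.matrix_mul continuous_id))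

variable {N : ℕ} (D : Microgrid N)

theorem ΦV_apply (x a b : D.Idx) : D.ΦV x a b = if a = x ∧ b = x then 1 else 0 := by
  simp only [ΦV, vecMulVec_apply, Pi.single_apply]
  split_ifs <;> simp_all

theorem Yat_apply (x a b : D.Idx) : D.Yat x a b = if a = x then D.Y x b else 0 := by
  simp only [Yat, Matrix.mul_apply, ΦV_apply]
  by_cases h : a = x <;> simp [h]

theorem tr_ΦV (x : D.Idx) (V : Matrix D.Idx D.Idx ℂ) : tr (D.ΦV x) V = (V x x).re := by
  simp only [tr, Matrix.trace, Matrix.diag_apply, Matrix.mul_apply, ΦV_apply]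
  congr 1
  rw [Finset.sum_eq_single x (fun a _ ha => by simp [ha]) (by simp)]
  simp

theorem Yat_ne_zero {x a b : D.Idx} (h : D.Yat x a b ≠ 0) :
    a = x ∧ (b.1.1 = x.1.1 ∨ D.lines.Adj x.1.1 b.1.1) := by
  rw [Yat_apply] at h
  by_cases ha : a = x
  · refine ⟨ha, ?_⟩
    rw [if_pos ha, Y] at h
    by_contra hc
    push Not at hc
    simp [hc.2, Ne.symm hc.1] at h
  · simp [ha] at h

theorem Aline_ne_zero {m n : Fin (N + 1)} {φ : D.linePhases s(m, n)} {x : D.Idx}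
    (h : D.Aline m n φ x ≠ 0) : x.1.1 ∈ s(m, n) := by
  rw [Aline] at h
  rw [Sym2.mem_iff]
  by_contra hc
  push Not at hc
  simp [hc.1, hc.2] at h

theorem Bline_ne_zero {m n : Fin (N + 1)} {φ : D.linePhases s(m, n)} {x : D.Idx}
    (h : D.Bline m n φ x ≠ 0) : x.1.1 ∈ s(m, n) := by
  rw [Bline] at h
  rw [Sym2.mem_iff]
  by_contra hc
  simp [mt Or.inl hc] at h

theorem Φflow_ne_zero {m n : Fin (N + 1)} {a b : D.Idx} (h : D.Φflow m n a b ≠ 0) :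
    a.1.1 ∈ s(m, n) ∧ b.1.1 ∈ s(m, n) := by
  have h1 : ((D.Aline m n)ᴴ * D.Bline m n) a b ≠ 0 ∨ ((D.Bline m n)ᴴ * D.Aline m n) a b ≠ 0 := by
    by_contra hc
    push Not at hc
    simp [Φflow, hc.1, hc.2] at h
  rcases h1 with h1 | h1 <;>
  · rw [Matrix.mul_apply] at h1
    obtain ⟨φ, -, hφ⟩ := Finset.exists_ne_zero_of_sum_ne_zero h1
    have h2 := left_ne_zero_of_mul hφ
    have h3 := right_ne_zero_of_mul hφ
    rw [Matrix.conjTranspose_apply, star_ne_zero] at h2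
    first
      | exact ⟨D.Aline_ne_zero h2, D.Bline_ne_zero h3⟩
      | exact ⟨D.Bline_ne_zero h2, D.Aline_ne_zero h3⟩

theorem Φline_ne_zero {e : Sym2 (Fin (N + 1))} {a b : D.Idx} (h : D.Φline e a b ≠ 0) :
    a.1.1 ∈ e ∧ b.1.1 ∈ e := by
  induction e with
  | _ m n =>
    have h1 : D.Φflow m n a b ≠ 0 ∨ D.Φflow n m a b ≠ 0 := by
      by_contra hc
      push Not at hc
      apply h
      change D.Φflow m n a b + D.Φflow n m a b = 0
      rw [hc.1, hc.2, add_zero]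
    rcases h1 with h1 | h1
    · exact D.Φflow_ne_zero h1
    · rw [Sym2.eq_swap]; exact D.Φflow_ne_zero h1

end Microgrid

/-! ### Locality of constraints and costs -/

namespace PartitionedMicrogrid

variable {N L : ℕ} (D : PartitionedMicrogrid N L)

theorem mem_ext_of_mem {l : Fin L} {n : Fin (N + 1)} (h : n ∈ D.A l) : n ∈ D.ext l := Or.inl h

theorem mem_ext_of_adj {l : Fin L} {m n : Fin (N + 1)} (h : m ∈ D.A l) (hmn : D.lines.Adj m n) :
    n ∈ D.ext l := by
  by_cases hn : n ∈ D.A l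
  · exact Or.inl hn
  · exact Or.inr ⟨hn, m, h, hmn⟩

theorem mem_nbr_of_mem {l j : Fin L} (hlj : l ≠ j) {n : Fin (N + 1)} (hl : n ∈ D.ext l)
    (hj : n ∈ D.ext j) : j ∈ D.nbr l :=
  (SimpleGraph.mem_neighborFinset _ _ _).2 ⟨hlj, n, hl, hj⟩

/-- Entries of V outside the extended area are multiplied by zero entries of Φ. -/
theorem tr_restrict {l : Fin L} {Φ : Matrix D.Idx D.Idx ℂ}
    (h : ∀ a b, Φ a b ≠ 0 → a.1.1 ∈ D.ext l ∧ b.1.1 ∈ D.ext l) (V : Matrix D.Idx D.Idx ℂ) :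
    Microgrid.tr (D.restrict l Φ) (D.restrict l V) = Microgrid.tr Φ V := by
  simp only [Microgrid.tr, Matrix.trace, Matrix.diag_apply, Matrix.mul_apply, restrict,
    Matrix.submatrix_apply]
  congr 1
  refine Fintype.sum_of_injective _ Subtype.val_injective _ _ (fun a ha => ?_) fun a => ?_
  · refine Finset.sum_eq_zero fun b _ => ?_
    have : Φ a b = 0 := by
      by_contra hc
      exact ha ⟨⟨a, (h a b hc).1⟩, rfl⟩
    rw [this, zero_mul]
  · refine Fintype.sum_of_injective _ Subtype.val_injective _ _ (fun b hb => ?_) fun b => rfl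
    have : Φ a.1 b = 0 := by
      by_contra hc
      exact hb ⟨⟨b, (h a.1 b hc).2⟩, rfl⟩
    rw [this, zero_mul]

theorem Yat_support {l : Fin L} {x : D.Idx} (hx : x.1.1 ∈ D.A l) {a b : D.Idx}
    (h : D.Yat x a b ≠ 0) : a.1.1 ∈ D.ext l ∧ b.1.1 ∈ D.ext l := by
  obtain ⟨rfl, hb⟩ := D.toMicrogrid.Yat_ne_zero h
  refine ⟨D.mem_ext_of_mem hx, ?_⟩
  rcases hb with hb | hb
  · rw [hb]; exact D.mem_ext_of_mem hx
  · exact D.mem_ext_of_adj hx hb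

theorem tr_restrict_ΦP {l : Fin L} {x : D.Idx} (hx : x.1.1 ∈ D.A l) (V : Matrix D.Idx D.Idx ℂ) :
    Microgrid.tr (D.restrict l (D.ΦP x)) (D.restrict l V) = Microgrid.tr (D.ΦP x) V := by
  refine D.tr_restrict (fun a b h => ?_) V
  by_cases h1 : D.Yat x a b = 0
  · have h2 : D.Yat x b a ≠ 0 := fun h2 => h (by simp [Microgrid.ΦP, h1, h2])
    exact (D.Yat_support hx h2).symm
  · exact D.Yat_support hx h1

theorem tr_restrict_ΦQ {l : Fin L} {x : D.Idx} (hx : x.1.1 ∈ D.A l) (V : Matrix D.Idx D.Idx ℂ) :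
    Microgrid.tr (D.restrict l (D.ΦQ x)) (D.restrict l V) = Microgrid.tr (D.ΦQ x) V := by
  refine D.tr_restrict (fun a b h => ?_) V
  by_cases h1 : D.Yat x a b = 0
  · have h2 : D.Yat x b a ≠ 0 := fun h2 => h (by simp [Microgrid.ΦQ, h1, h2])
    exact (D.Yat_support hx h2).symm
  · exact D.Yat_support hx h1

theorem tr_restrict_ΦV {l : Fin L} {x : D.Idx} (hx : x.1.1 ∈ D.ext l) (V : Matrix D.Idx D.Idx ℂ) :
    Microgrid.tr (D.restrict l (D.ΦV x)) (D.restrict l V) = Microgrid.tr (D.ΦV x) V := by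
  refine D.tr_restrict (fun a b h => ?_) V
  rw [Microgrid.ΦV_apply] at h
  obtain ⟨rfl, rfl⟩ : a = x ∧ b = x := by
    by_contra hc
    exact h (if_neg hc)
  exact ⟨hx, hx⟩

theorem tr_restrict_Φline {l : Fin L} {e : Sym2 (Fin (N + 1))} (he : ∀ n ∈ e, n ∈ D.ext l)
    (V : Matrix D.Idx D.Idx ℂ) :
    Microgrid.tr (D.restrict l (D.Φline e)) (D.restrict l V) = Microgrid.tr (D.Φline e) V :=
  D.tr_restrict (fun _ _ h => ⟨he _ (D.toMicrogrid.Φline_ne_zero h).1,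
    he _ (D.toMicrogrid.Φline_ne_zero h).2⟩) V

/-- The local constraint sets cut the centralized constraints into areas. -/
theorem feasibleSDP_iff {V : Matrix D.Idx D.Idx ℂ} (hV : V.PosSemidef) :
    D.FeasibleSDP V ↔ ∀ l, D.restrict l V ∈ D.localSet l := by
  constructor
  · intro h l
    refine ⟨hV.submatrix _, ⟨fun x hx hS => ?_, fun x hx hS => ?_, fun x hx hS => ?_,
      fun x hx hS => ?_, fun x hx => ?_, fun _ x y hx hy => h.pcc x.1 y.1 hx hy⟩⟩
    · rw [D.tr_restrict_ΦP hx]; exact h.loadP x hS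
    · rw [D.tr_restrict_ΦQ hx, D.tr_restrict_ΦV (D.mem_ext_of_mem hx)]; exact h.loadQ x hS
    · rw [D.tr_restrict_ΦP hx]; exact h.genP x hS
    · rw [D.tr_restrict_ΦQ hx]; exact h.genQ x hS
    · rw [D.tr_restrict_ΦV (D.mem_ext_of_mem hx)]; exact h.voltage x
  · intro h
    have hA : ∀ n : Fin (N + 1), n ∈ D.A (D.area n) := fun n => rfl
    refine ⟨fun x hS => ?_, fun x hS => ?_, fun x hS => ?_, fun x hS => ?_, fun x => ?_,
      fun x y hx hy => ?_, hV⟩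
    · have := (h (D.area x.1.1)).2.loadP x (hA _) hS
      rwa [D.tr_restrict_ΦP (hA _)] at this
    · have := (h (D.area x.1.1)).2.loadQ x (hA _) hS
      rwa [D.tr_restrict_ΦQ (hA _), D.tr_restrict_ΦV (D.mem_ext_of_mem (hA _))] at this
    · have := (h (D.area x.1.1)).2.genP x (hA _) hS
      rwa [D.tr_restrict_ΦP (hA _)] at this
    · have := (h (D.area x.1.1)).2.genQ x (hA _) hS
      rwa [D.tr_restrict_ΦQ (hA _)] at this
    · have := (h (D.area x.1.1)).2.voltage x (hA _)
      rwa [D.tr_restrict_ΦV (D.mem_ext_of_mem (hA _))] at this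
    · have h0 : ∀ z : D.Idx, z.1.1 = 0 → z.1.1 ∈ D.ext (D.area 0) := fun z hz => by
        rw [hz]; exact D.mem_ext_of_mem (hA 0)
      exact (h (D.area 0)).2.pcc (hA 0) ⟨x, h0 x hx⟩ ⟨y, h0 y hy⟩ hx hy

/-- A line inside an area is counted once, by that area; a line between two areas is counted half by
each. -/
theorem sum_lossCost (V : Matrix D.Idx D.Idx ℂ) :
    ∑ l, D.lossCost l (D.restrict l V) = D.cost .losses V := by
  have h1 : ∀ l, D.lossCost l (D.restrict l V) = ∑ e ∈ D.lines.edgeFinset,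
      ((if ∀ n ∈ e, n ∈ D.A l then Microgrid.tr (D.Φline e) V else 0)
        + if (∃ m ∈ e, m ∈ D.A l) ∧ ∃ n ∈ e, n ∈ D.ext l \ D.A l then
          (1 / 2 : ℝ) * Microgrid.tr (D.Φline e) V else 0) := by
    intro l
    rw [lossCost, Finset.sum_add_distrib, ← Finset.sum_filter, ← Finset.sum_filter]
    congr 1
    · refine Finset.sum_congr rfl fun e he => D.tr_restrict_Φline (fun n hn => ?_) V
      exact D.mem_ext_of_mem ((Finset.mem_filter.1 he).2 n hn)
    · refine Finset.sum_congr rfl fun e he => ?_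
      rw [D.tr_restrict_Φline (fun n hn => ?_) V]
      obtain ⟨he, ⟨m, hm, hmA⟩, -⟩ := Finset.mem_filter.1 he
      by_cases hnm : n = m
      · rw [hnm]; exact D.mem_ext_of_mem hmA
      · have : e = s(m, n) := ((Sym2.mem_and_mem_iff (Ne.symm hnm)).1 ⟨hm, hn⟩)
        rw [this, SimpleGraph.mem_edgeFinset, SimpleGraph.mem_edgeSet] at he
        exact D.mem_ext_of_adj hmA he
  simp only [h1]
  rw [Finset.sum_comm]
  refine Finset.sum_congr rfl fun e he => ?_
  generalize Microgrid.tr (D.Φline e) V = t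
  induction e with
  | _ m n =>
    rw [SimpleGraph.mem_edgeFinset, SimpleGraph.mem_edgeSet] at he
    have h2 : ∀ l, (∀ k ∈ s(m, n), k ∈ D.A l) ↔ D.area m = l ∧ D.area n = l := fun l => by
      simp [A]
    have h3 : ∀ l, ((∃ k ∈ s(m, n), k ∈ D.A l) ∧ ∃ k ∈ s(m, n), k ∈ D.ext l \ D.A l) ↔
        (D.area m = l ∨ D.area n = l) ∧ D.area m ≠ D.area n := fun l => by
      constructor
      · rintro ⟨⟨k, hk, hkA⟩, k', hk', -, hkA'⟩
        rw [Sym2.mem_iff] at hk hk'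
        simp only [A, Set.mem_ofPred_eq] at hkA hkA'
        rcases hk with rfl | rfl <;> rcases hk' with rfl | rfl <;> grind
      · rintro ⟨h | h, hne⟩
        · exact ⟨⟨m, Sym2.mem_mk_left _ _, h⟩, n, Sym2.mem_mk_right _ _, D.mem_ext_of_adj h he,
            fun h' => hne (h.trans (Eq.symm h'))⟩
        · exact ⟨⟨n, Sym2.mem_mk_right _ _, h⟩, m, Sym2.mem_mk_left _ _, D.mem_ext_of_adj h he.symm,
            fun h' => hne (Eq.trans h' h.symm)⟩
    simp only [h2, h3]
    by_cases hmn : D.area m = D.area n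
    · simp [hmn]
    · have h4 : ∀ l, (if D.area m = l ∧ D.area n = l then t else 0)
          + (if (D.area m = l ∨ D.area n = l) ∧ D.area m ≠ D.area n then 1 / 2 * t else 0)
          = (if D.area m = l then 1 / 2 * t else 0) + if D.area n = l then 1 / 2 * t else 0 := by
        intro l
        by_cases ha : D.area m = l <;> by_cases hb : D.area n = l
        · exact absurd (ha.trans hb.symm) hmn
        all_goals simp [ha, hb, hmn]
        exact fun h => absurd h (Ne.symm hb)
      simp only [h4, Finset.sum_add_distrib, Finset.sum_ite_eq, Finset.mem_univ, if_true]
      ring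

variable {D}

theorem IsLocalCost.sum_eq {C : ∀ l, D.AreaMat l → ℝ} {m : Objective} (hC : D.IsLocalCost C m)
    {V : Matrix D.Idx D.Idx ℂ} (hV : D.FeasibleSDP V) :
    ∑ l, C l (D.restrict l V) = D.cost m V := by
  cases m with
  | losses =>
    rw [← D.sum_lossCost V]
    exact Finset.sum_congr rfl fun l _ => congrFun (hC l) _
  | supply => exact hC.2 V hV

theorem IsLocalCost.affine {C : ∀ l, D.AreaMat l → ℝ} {m : Objective} (hC : D.IsLocalCost C m)
    (l : Fin L) : ∃ f : D.AreaMat l →ᵃ[ℝ] ℝ, C l = f := by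
  cases m with
  | losses =>
    refine ⟨((∑ e ∈ D.lines.edgeFinset with ∀ n ∈ e, n ∈ D.A l,
        Microgrid.trLin (D.restrict l (D.Φline e)))
      + ∑ e ∈ D.lines.edgeFinset with (∃ m ∈ e, m ∈ D.A l) ∧ ∃ n ∈ e, n ∈ D.ext l \ D.A l,
        (1 / 2 : ℝ) • Microgrid.trLin (D.restrict l (D.Φline e))).toAffineMap, ?_⟩
    rw [hC l]
    ext V
    simp only [lossCost, LinearMap.coe_toAffineMap, LinearMap.add_apply, LinearMap.sum_apply,
      LinearMap.smul_apply, smul_eq_mul]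
    rfl
  | supply => exact hC.1 l

theorem IsLocalCost.continuous {C : ∀ l, D.AreaMat l → ℝ} {m : Objective}
    (hC : D.IsLocalCost C m) : Continuous fun V : ∀ l, D.AreaMat l => ∑ l, C l (V l) := by
  refine continuous_finsetSum _ fun l _ => ?_
  obtain ⟨f, hf⟩ := hC.affine l
  have hc : Continuous f := by
    rw [f.decomp]
    exact f.linear.continuous_of_finiteDimensional.add continuous_const
  rw [hf]
  exact hc.comp (continuous_apply l)

/-! ### Convexity, closedness and boundedness of the local constraint sets -/

variable (D)

theorem convex_localSet (l : Fin L) : Convex ℝ (D.localSet l) := by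
  intro V hV V' hV' a b ha hb hab
  have hIcc : ∀ {p q u v w: ℝ}, p + w ∈ Set.Icc u v → q + w ∈ Set.Icc u v →
      a * p + b * q + w ∈ Set.Icc u v := by
    intro p q u v w hp hq
    have := convex_Icc u v hp hq ha hb hab
    convert this using 1
    simp only [smul_eq_mul]
    linear_combination (-w) * hab
  refine ⟨Matrix.convex_posSemidef hV.1 hV'.1 ha hb hab, ⟨fun x hx hS => ?_, fun x hx hS => ?_,
    fun x hx hS => ?_, fun x hx hS => ?_, fun x hx => ?_, fun h0 x y hx hy => ?_⟩⟩ <;>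
    try simp only [Microgrid.tr_add, Microgrid.tr_smul]
  · linear_combination a * hV.2.loadP x hx hS + b * hV'.2.loadP x hx hS
      - D.PL x.1.1 x.1.2 * hab
  · linear_combination a * hV.2.loadQ x hx hS + b * hV'.2.loadQ x hx hS
      - D.QL x.1.1 x.1.2 * hab
  · exact hIcc (hV.2.genP x hx hS) (hV'.2.genP x hx hS)
  · exact hIcc (hV.2.genQ x hx hS) (hV'.2.genQ x hx hS)
  · have := @hIcc _ _ _ _ 0 (by simpa using hV.2.voltage x hx) (by simpa using hV'.2.voltage x hx)
    simpa using this
  · rw [Matrix.add_apply, Matrix.smul_apply, Matrix.smul_apply, hV.2.pcc h0 x y hx hy,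
      hV'.2.pcc h0 x y hx hy, ← add_smul, hab, one_smul]

theorem isClosed_localSet (l : Fin L) : IsClosed (D.localSet l) := by
  refine isClosed_of_closure_subset fun V hV => ?_
  obtain ⟨u, hu, hlim⟩ := mem_closure_iff_seq_limit.1 hV
  have ht : ∀ Φ, Tendsto (fun n => Microgrid.tr Φ (u n)) atTop (𝓝 (Microgrid.tr Φ V)) :=
    fun Φ => ((Microgrid.continuous_tr Φ).tendsto V).comp hlim
  refine ⟨Matrix.isClosed_posSemidef.mem_of_tendsto hlim (Eventually.of_forall fun n => (hu n).1),
    ⟨fun x hx hS => ?_, fun x hx hS => ?_,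
    fun x hx hS => ?_, fun x hx hS => ?_, fun x hx => ?_, fun h0 x y hx hy => ?_⟩⟩
  · exact tendsto_nhds_unique ((ht _).add_const _)
      (tendsto_const_nhds.congr fun n => ((hu n).2.loadP x hx hS).symm)
  · exact tendsto_nhds_unique (((ht _).add_const _).sub ((ht _).const_mul _))
      (tendsto_const_nhds.congr fun n => ((hu n).2.loadQ x hx hS).symm)
  · exact isClosed_Icc.mem_of_tendsto ((ht _).add_const _)
      (Eventually.of_forall fun n => (hu n).2.genP x hx hS)
  · exact isClosed_Icc.mem_of_tendsto ((ht _).add_const _)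
      (Eventually.of_forall fun n => (hu n).2.genQ x hx hS)
  · exact isClosed_Icc.mem_of_tendsto (ht _) (Eventually.of_forall fun n => (hu n).2.voltage x hx)
  · have h1 : Tendsto (fun n => u n x y) atTop (𝓝 (V x y)) :=
      ((continuous_id.matrix_elem x y).tendsto V).comp hlim
    exact tendsto_nhds_unique h1
      (tendsto_const_nhds.congr fun n => ((hu n).2.pcc h0 x y hx hy).symm)

theorem continuous_coupMap : Continuous D.coupMap := by
  have h : ∀ k : D.PairEntry, Continuous fun V : ∀ l, D.AreaMat l =>
      V k.1 ⟨k.2.2.1.1, k.2.2.1.2.1⟩ ⟨k.2.2.2.1, k.2.2.2.2.1⟩ := fun k =>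
    Continuous.matrix_elem (A := fun V : ∀ l, D.AreaMat l => V k.1) (continuous_apply k.1) _ _
  refine (PiLp.continuous_toLp 2 _).comp (continuous_pi fun k => ?_)
  rcases k with k | k
  · exact Complex.continuous_re.comp (h k)
  · exact Complex.continuous_im.comp (h k)

/-- Local matrices in the local constraint sets are bounded in terms of their shared blocks. -/
theorem exists_norm_le (R : ℝ) : ∃ B, ∀ V : ∀ l, D.AreaMat l, (∀ l, V l ∈ D.localSet l) →
    ‖D.coupMap V‖ ≤ R → ∀ l x y, ‖V l x y‖ ≤ B := by
  refine ⟨max R (∑ n, D.Vmax n ^ 2), fun V hV hR l x y =>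
    (hV l).1.norm_apply_le (fun x => ?_) x y⟩
  -- It suffices to bound the diagonal. A node owned by l has a voltage limit; any other node of the
  -- extended area also lies in that of its owner, so its diagonal entry occurs in a shared block.
  by_cases hx : x.1.1.1 ∈ D.A l
  · refine le_trans ?_ (le_max_right _ _)
    have h1 : Microgrid.tr (D.restrict l (D.ΦV x.1)) (V l) = (V l x x).re := by
      -- Zero padding makes the local matrix a restriction, so that `tr_restrict_ΦV` applies.
      let M : Matrix D.Idx D.Idx ℂ := fun a b =>
        if h : a.1.1 ∈ D.ext l ∧ b.1.1 ∈ D.ext l then V l ⟨a, h.1⟩ ⟨b, h.2⟩ else 0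
      have hM : D.restrict l M = V l := by
        ext a b
        exact dif_pos ⟨a.2, b.2⟩
      rw [← hM, D.tr_restrict_ΦV x.2, Microgrid.tr_ΦV]
      rfl
    rw [← h1]
    exact ((hV l).2.voltage x.1 hx).2.trans
      (Finset.single_le_sum (fun n _ => sq_nonneg (D.Vmax n)) (Finset.mem_univ _))
  · refine le_trans ?_ (le_max_left _ _)
    have hne : l ≠ D.area x.1.1.1 := fun h => hx h.symm
    have hxj : x.1.1.1 ∈ D.ext (D.area x.1.1.1) := D.mem_ext_of_mem rfl
    let k : D.PairEntry := ⟨l, ⟨_, D.mem_nbr_of_mem hne x.2 hxj⟩, ⟨x.1, x.2, hxj⟩, ⟨x.1, x.2, hxj⟩⟩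
    exact (le_abs_self _).trans ((PiLp.norm_apply_le (D.coupMap V) (Sum.inl k)).trans hR)

/-- Families of local matrices with entries bounded by `B`. -/
def boundedFamilies (B : ℝ) : Set (∀ l, D.AreaMat l) := {V | ∀ l x y, ‖V l x y‖ ≤ B}

theorem isCompact_boundedFamilies (B : ℝ) : IsCompact (D.boundedFamilies B) := by
  have h : IsCompact (Set.pi Set.univ fun l : Fin L => (Set.pi Set.univ fun _ : D.AreaIdx l =>
      Set.pi Set.univ fun _ : D.AreaIdx l => Metric.closedBall (0 : ℂ) B)) :=
    isCompact_univ_pi fun _ => isCompact_univ_pi fun _ => isCompact_univ_pi fun _ =>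
      isCompact_closedBall _ _
  have e : D.boundedFamilies B = Set.pi Set.univ fun l : Fin L => (Set.pi Set.univ
      fun _ : D.AreaIdx l => Set.pi Set.univ fun _ : D.AreaIdx l => Metric.closedBall (0 : ℂ) B) :=
    Set.ext fun V =>
      ⟨fun h l _ x _ y _ => mem_closedBall_zero_iff.2 (h l x y),
        fun h l x y => mem_closedBall_zero_iff.1 (h l trivial x trivial y trivial)⟩
  rw [e]
  exact h

/-! ### Gluing local matrices along the tree of areas -/

theorem apply_eq_of_mem_consensus {V : ∀ l, D.AreaMat l} (hV : D.coupMap V ∈ D.consensusSpace)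
    {l j : Fin L} (hj : D.macroGraph.Adj l j) {x y : D.Idx} (hxl : x.1.1 ∈ D.ext l)
    (hxj : x.1.1 ∈ D.ext j) (hyl : y.1.1 ∈ D.ext l) (hyj : y.1.1 ∈ D.ext j) :
    V l ⟨x, hxl⟩ ⟨y, hyl⟩ = V j ⟨x, hxj⟩ ⟨y, hyj⟩ := by
  have h := hV ⟨l, ⟨j, (SimpleGraph.mem_neighborFinset _ _ _).2 hj⟩, ⟨x, hxl, hxj⟩, ⟨y, hyl, hyj⟩⟩
  exact Complex.ext h.1.symm h.2.symm

theorem coupMap_restrict_mem (V : Matrix D.Idx D.Idx ℂ) :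
    D.coupMap (fun l => D.restrict l V) ∈ D.consensusSpace := fun _ => ⟨rfl, rfl⟩

/-- Positive semidefinite completion over a tree of areas. -/
theorem exists_completion (htree : D.MacroTree) {V : ∀ l, D.AreaMat l}
    (hpsd : ∀ l, (V l).PosSemidef) (hV : D.coupMap V ∈ D.consensusSpace) :
    ∃ M : Matrix D.Idx D.Idx ℂ, M.PosSemidef ∧ ∀ l, D.restrict l M = V l := by
  choose v hv using fun l => (hpsd l).exists_inner_eq (e := fun x : D.AreaIdx l => x.1)
    Subtype.val_injective
  -- By consensus, neighboring areas assign equal Gram matrices to their shared vectors, so an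
  -- isometry chosen for one area determines a compatible one for the other.
  obtain ⟨T, hT⟩ := SimpleGraph.IsTree.exists_integral htree
    (β := EuclideanSpace ℂ D.Idx →ₗᵢ[ℂ] EuclideanSpace ℂ D.Idx)
    (fun l j s t => ∀ (x : D.Idx) (hl : x.1.1 ∈ D.ext l) (hj : x.1.1 ∈ D.ext j),
      s (v l ⟨x, hl⟩) = t (v j ⟨x, hj⟩))
    (fun l j s t h x hj hl => (h x hl hj).symm)
    (fun l j hadj t => by
      obtain ⟨s, hs⟩ := exists_linearIsometry_of_inner_eq
        (fun x : D.SharedIdx l j => v l ⟨x.1, x.2.1⟩) (fun x => t (v j ⟨x.1, x.2.2⟩))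
        (fun x y => by
          rw [t.inner_map_map, hv, hv]
          exact D.apply_eq_of_mem_consensus hV hadj _ _ _ _)
      exact ⟨s, fun x hl hj => hs ⟨x, hl, hj⟩⟩)
  have hmem : ∀ x : D.Idx, x.1.1 ∈ D.ext (D.area x.1.1) := fun x => D.mem_ext_of_mem rfl
  let c : D.Idx → EuclideanSpace ℂ D.Idx := fun x => T (D.area x.1.1) (v _ ⟨x, hmem x⟩)
  -- The vector of x does not depend on the area used: any two distinct extended areas containing
  -- its node overlap and are therefore adjacent in the tree.
  have hc : ∀ l (x : D.Idx) (hx : x.1.1 ∈ D.ext l), c x = T l (v l ⟨x, hx⟩) := by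
    intro l x hx
    by_cases h : D.area x.1.1 = l
    · subst h; rfl
    · exact hT _ _ ⟨h, x.1.1, hmem x, hx⟩ x (hmem x) hx
  refine ⟨Matrix.gram ℂ c, Matrix.posSemidef_gram ℂ c, fun l => ?_⟩
  ext x y
  change ⟪c x.1, c y.1⟫_ℂ = V l x y
  rw [hc l x.1 x.2, hc l y.1 y.2, (T l).inner_map_map, hv]

end PartitionedMicrogrid

/-! ### Saddle points, optimality of limits and convergence -/

namespace PartitionedMicrogrid

variable {N L : ℕ} {D : PartitionedMicrogrid N L} {C : ∀ l, D.AreaMat l → ℝ} {m : Objective}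

theorem convex_localSets (D : PartitionedMicrogrid N L) :
    Convex ℝ {V : ∀ l, D.AreaMat l | ∀ l, V l ∈ D.localSet l} :=
  fun _ hU _ hV _ _ ha hb hab l => D.convex_localSet l (hU l) (hV l) ha hb hab

theorem isClosed_localSets (D : PartitionedMicrogrid N L) :
    IsClosed {V : ∀ l, D.AreaMat l | ∀ l, V l ∈ D.localSet l} := by
  simp only [Set.ofPred_forall]
  exact isClosed_iInter fun l => (D.isClosed_localSet l).preimage (continuous_apply l)

theorem IsLocalCost.convexOn (hC : D.IsLocalCost C m) :
    ConvexOn ℝ {V | ∀ l, V l ∈ D.localSet l} fun V : ∀ l, D.AreaMat l => ∑ l, C l (V l) := by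
  refine ⟨D.convex_localSets, fun U _ V _ a b _ _ hab => le_of_eq ?_⟩
  rw [Finset.smul_sum, Finset.smul_sum, ← Finset.sum_add_distrib]
  refine Finset.sum_congr rfl fun l _ => ?_
  obtain ⟨f, hf⟩ := hC.affine l
  rw [hf]
  exact Convex.combo_affine_apply hab

/-- An optimal solution and Lagrange multipliers form a saddle point. -/
theorem isSaddle_of_isMultiplier {Vopt : Matrix D.Idx D.Idx ℂ} (hopt : D.OptimalSDP m Vopt)
    {Γs Λs : D.PairMat} (hs : D.IsMultiplier C (∑ l, C l (D.restrict l Vopt)) Γs Λs) :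
    IsSaddle {V | ∀ l, V l ∈ D.localSet l} (fun V : ∀ l, D.AreaMat l => ∑ l, C l (V l))
      D.coupMap D.consensusSpace (fun l => D.restrict l Vopt) (D.coupVec Γs Λs) := by
  have hmem : ∀ l, D.restrict l Vopt ∈ D.localSet l := (D.feasibleSDP_iff hopt.1.psd).1 hopt.1
  have h : ∀ (V : ∀ l, D.AreaMat l), (∀ l, V l ∈ D.localSet l) → ∀ w ∈ D.consensusSpace,
      ∑ l, C l (D.restrict l Vopt) ≤ ∑ l, C l (V l) + ⟪D.coupVec Γs Λs, D.coupMap V - w⟫_ℝ := by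
    intro V hV w hw
    obtain ⟨W, X, rfl⟩ := D.coupVec_surjective w
    obtain ⟨hW, hX⟩ := D.coupVec_mem_consensusSpace.1 hw
    have := hs V W X hV hW hX
    rw [D.lagrangian_eq C 0 V Γs Λs hW hX] at this
    simpa using this
  have horth : D.coupVec Γs Λs ∈ D.consensusSpaceᗮ := by
    rw [Submodule.mem_orthogonal']
    intro w hw
    have h1 : ∀ u ∈ D.consensusSpace, 0 ≤ ⟪D.coupVec Γs Λs, u⟫_ℝ := fun u hu => by
      -- Test at the optimum itself with w = A V_opt - u: the costs cancel and ⟪g, u⟫ ≥ 0 remains. A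
      -- linear functional nonnegative on a subspace vanishes there.
      have := h _ hmem _ (D.consensusSpace.sub_mem (D.coupMap_restrict_mem Vopt) hu)
      rw [sub_sub_cancel] at this
      linarith
    have h2 := h1 _ (D.consensusSpace.neg_mem hw)
    rw [inner_neg_right] at h2
    linarith [h1 w hw]
  refine ⟨hmem, D.coupMap_restrict_mem Vopt, horth, fun V hV => ?_⟩
  simpa using h V hV 0 (Submodule.zero_mem _)

/-- A consensual family of feasible local matrices that is at least as good as the optimum comes from
an optimal solution of the centralized problem. -/
theorem IsLocalCost.exists_optimal (hC : D.IsLocalCost C m) (htree : D.MacroTree)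
    {Vopt : Matrix D.Idx D.Idx ℂ} (hopt : D.OptimalSDP m Vopt) {U : ∀ l, D.AreaMat l}
    (hU : ∀ l, U l ∈ D.localSet l) (hUc : D.coupMap U ∈ D.consensusSpace)
    (hle : ∑ l, C l (U l) ≤ ∑ l, C l (D.restrict l Vopt)) :
    ∃ V', D.OptimalSDP m V' ∧ ∀ l, U l = D.restrict l V' := by
  obtain ⟨M, hM, hMU⟩ := D.exists_completion htree (fun l => (hU l).1) hUc
  have hfeas : D.FeasibleSDP M := (D.feasibleSDP_iff hM).2 fun l => by rw [hMU]; exact hU l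
  refine ⟨M, ⟨hfeas, fun V' hV' => ?_⟩, fun l => (hMU l).symm⟩
  refine le_trans ?_ (hopt.2 V' hV')
  rw [← hC.sum_eq hfeas, ← hC.sum_eq hopt.1]
  simpa only [hMU] using hle

theorem tendsto_multipliers {Γ Λ : ℕ → D.PairMat} {g : D.CouplingSpace}
    (h : Tendsto (fun i => D.coupVec (Γ i) (Λ i)) atTop (𝓝 g)) :
    ∃ Γlim Λlim : D.PairMat, ∀ l, ∀ j ∈ D.nbr l,
      Tendsto (fun i => Γ i l j) atTop (𝓝 (Γlim l j)) ∧
      Tendsto (fun i => Λ i l j) atTop (𝓝 (Λlim l j)) := by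
  obtain ⟨P, Q, rfl⟩ := D.coupVec_surjective g
  have h1 : ∀ k, Tendsto (fun i => D.coupVec (Γ i) (Λ i) k) atTop (𝓝 (D.coupVec P Q k)) := fun k =>
    ((PiLp.continuous_apply 2 _ k).tendsto _).comp h
  exact ⟨P, Q, fun l j hj =>
    ⟨tendsto_pi_nhds.2 fun a => tendsto_pi_nhds.2 fun b => h1 (Sum.inl ⟨l, ⟨j, hj⟩, a, b⟩),
      tendsto_pi_nhds.2 fun a => tendsto_pi_nhds.2 fun b => h1 (Sum.inr ⟨l, ⟨j, hj⟩, a, b⟩)⟩⟩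

/-- The initial matrices are arbitrary, so they need a bound of their own. -/
theorem exists_norm_le_of_succ {V : ℕ → ∀ l, D.AreaMat l} {B : ℝ}
    (h : ∀ i, V (i + 1) ∈ D.boundedFamilies B) : ∃ R : ℝ, ∀ i l x y, ‖V i l x y‖ ≤ R := by
  refine ⟨B ⊔ ∑ l, ∑ x, ∑ y, ‖V 0 l x y‖, fun i l x y => ?_⟩
  cases i with
  | zero =>
    refine le_trans ?_ (le_max_right _ _)
    calc ‖V 0 l x y‖ ≤ ∑ y, ‖V 0 l x y‖ :=
          Finset.single_le_sum (f := fun y => ‖V 0 l x y‖) (fun _ _ => norm_nonneg _)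
            (Finset.mem_univ y)
      _ ≤ ∑ x, ∑ y, ‖V 0 l x y‖ :=
          Finset.single_le_sum (f := fun x => ∑ y, ‖V 0 l x y‖)
            (fun _ _ => Finset.sum_nonneg fun _ _ => norm_nonneg _) (Finset.mem_univ x)
      _ ≤ ∑ l, ∑ x, ∑ y, ‖V 0 l x y‖ :=
          Finset.single_le_sum (f := fun l => ∑ x, ∑ y, ‖V 0 l x y‖)
            (fun _ _ => Finset.sum_nonneg fun _ _ => Finset.sum_nonneg fun _ _ => norm_nonneg _)
            (Finset.mem_univ l)
  | succ i => exact (h i l x y).trans (le_max_left _ _)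

/-- Convergence of the local updates. -/
theorem convergence_of_steps (htree : D.MacroTree) (hC : D.IsLocalCost C m) {κ : ℝ} (hκ : 0 < κ)
    {V : ℕ → ∀ l, D.AreaMat l} {Γ Λ : ℕ → D.PairMat}
    (hP : ∀ i, D.PrimalStep C κ (V i) (V (i + 1)) (Γ i) (Λ i))
    (hD : ∀ i, D.DualStep κ (V (i + 1)) (Γ i) (Λ i) (Γ (i + 1)) (Λ (i + 1)))
    (hΓ : D.ZeroMult (Γ 0)) (hΛ : D.ZeroMult (Λ 0))
    {Vopt : Matrix D.Idx D.Idx ℂ} (hopt : D.OptimalSDP m Vopt)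
    {Γs Λs : D.PairMat} (hs : D.IsMultiplier C (∑ l, C l (D.restrict l Vopt)) Γs Λs) :
    (∃ Γlim Λlim : D.PairMat, ∀ l, ∀ j ∈ D.nbr l,
      Tendsto (fun i => Γ i l j) atTop (𝓝 (Γlim l j)) ∧
      Tendsto (fun i => Λ i l j) atTop (𝓝 (Λlim l j))) ∧
    (∃ R : ℝ, ∀ i l x y, ‖V i l x y‖ ≤ R) ∧
    (∀ U, MapClusterPt U atTop V → ∃ V', D.OptimalSDP m V' ∧ ∀ l, U l = D.restrict l V') ∧
    ((∀ V', D.OptimalSDP m V' → ∀ l, D.restrict l V' = D.restrict l Vopt) →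
      ∀ l, Tendsto (fun i => V i l) atTop (𝓝 (D.restrict l Vopt))) := by
  have hrun := admmRun_of_steps hκ hC.convexOn hP hD hΓ hΛ
  have hsad := isSaddle_of_isMultiplier hopt hs
  obtain ⟨R, hR⟩ := hrun.exists_bound hκ hsad
  obtain ⟨B, hB⟩ := D.exists_norm_le R
  have hVB : ∀ i, V (i + 1) ∈ D.boundedFamilies B := fun i => hB _ (hrun.mem i) (hR i).2
  have hcomp := D.isCompact_boundedFamilies B
  have hlim : ∀ U, MapClusterPt U atTop V →
      ∃ V', D.OptimalSDP m V' ∧ ∀ l, U l = D.restrict l V' := fun U hU => by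
    obtain ⟨h1, h2, h3⟩ := hrun.mem_of_mapClusterPt hκ D.isClosed_localSets hC.continuous
      D.continuous_coupMap hsad hcomp hVB hU
    exact hC.exists_optimal htree hopt h1 h2 h3
  refine ⟨?_, exists_norm_le_of_succ hVB, hlim, fun huniq => ?_⟩
  · obtain ⟨z, hz⟩ := hrun.exists_tendsto_G hκ D.isClosed_localSets hC.continuous
      D.continuous_coupMap hsad hcomp hVB
    -- The multipliers are the Kᗮ-component of the convergent sequence Z.
    have h1 := ((D.consensusSpaceᗮ).starProjection.continuous.tendsto z).comp hz
    simp only [Function.comp_def, hrun.starProjection_eq_G] at h1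
    exact tendsto_multipliers h1
  · have h1 : Tendsto V atTop (𝓝 fun l => D.restrict l Vopt) := by
      refine hcomp.tendsto_nhds_of_unique_mapClusterPt ?_ fun U _ hU => ?_
      · filter_upwards [eventually_gt_atTop 0] with i hi
        obtain ⟨k, rfl⟩ := Nat.exists_eq_add_of_lt hi
        rw [zero_add]
        exact hVB k
      · obtain ⟨V', hV', hUV⟩ := hlim U hU
        exact funext fun l => (hUV l).trans (huniq V' hV' l)
    exact tendsto_pi_nhds.1 h1

end PartitionedMicrogrid

end

theorem proposition3 {N L : ℕ} (D : PartitionedMicrogrid N L) (htree : D.MacroTree) (hnest : D.NoNested)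
    (m : Objective) (C : ∀ l, D.AreaMat l → ℝ) (hC : D.IsLocalCost C m)
    (κ : ℝ) (hκ : 0 < κ) :
    -- ADMM with zero initial multipliers boils down to the local primal and dual updates
    (∀ (V : ℕ → ∀ l, D.AreaMat l) (W X Γ Λ : ℕ → D.PairMat),
      D.IsADMM C κ V W X Γ Λ → D.ZeroMult (Γ 0) → D.ZeroMult (Λ 0) →
        (∀ i, D.DualStep κ (V (i + 1)) (Γ i) (Λ i) (Γ (i + 1)) (Λ (i + 1))) ∧
        (∀ i, 0 < i → D.PrimalStep C κ (V i) (V (i + 1)) (Γ i) (Λ i)) ∧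
        ((∀ l, ∀ j ∈ D.nbr l, W 0 l j = (D.avg (V 0) l j).map Complex.re ∧
            X 0 l j = (D.avg (V 0) l j).map Complex.im) →
          D.PrimalStep C κ (V 0) (V 1) (Γ 0) (Λ 0))) ∧
    -- conversely, every run of the local updates is an ADMM run
    (∀ (V : ℕ → ∀ l, D.AreaMat l) (Γ Λ : ℕ → D.PairMat),
      (∀ i, D.PrimalStep C κ (V i) (V (i + 1)) (Γ i) (Λ i)) →
      (∀ i, D.DualStep κ (V (i + 1)) (Γ i) (Λ i) (Γ (i + 1)) (Λ (i + 1))) →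
      D.ZeroMult (Γ 0) → D.ZeroMult (Λ 0) →
        D.IsADMM C κ V (fun i l j => (D.avg (V i) l j).map Complex.re)
          (fun i l j => (D.avg (V i) l j).map Complex.im) Γ Λ) ∧
    -- convergence of the local updates
    (∀ (V : ℕ → ∀ l, D.AreaMat l) (Γ Λ : ℕ → D.PairMat),
      (∀ i, D.PrimalStep C κ (V i) (V (i + 1)) (Γ i) (Λ i)) →
      (∀ i, D.DualStep κ (V (i + 1)) (Γ i) (Λ i) (Γ (i + 1)) (Λ (i + 1))) →
      D.ZeroMult (Γ 0) → D.ZeroMult (Λ 0) →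
      ∀ Vopt, D.OptimalSDP m Vopt →
      (∃ Γs Λs, D.IsMultiplier C (∑ l, C l (D.restrict l Vopt)) Γs Λs) →
        (∃ Γlim Λlim : D.PairMat, ∀ l, ∀ j ∈ D.nbr l,
          Tendsto (fun i => Γ i l j) atTop (𝓝 (Γlim l j)) ∧
          Tendsto (fun i => Λ i l j) atTop (𝓝 (Λlim l j))) ∧
        (∃ R : ℝ, ∀ i l x y, ‖V i l x y‖ ≤ R) ∧
        (∀ U, MapClusterPt U atTop V →
          ∃ V', D.OptimalSDP m V' ∧ ∀ l, U l = D.restrict l V') ∧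
        ((∀ V', D.OptimalSDP m V' → ∀ l, D.restrict l V' = D.restrict l Vopt) →
          ∀ l, Tendsto (fun i => V i l) atTop (𝓝 (D.restrict l Vopt)))) := by
  refine ⟨fun V W X Γ Λ h hΓ hΛ => ⟨h.dualStep hκ hΓ hΛ, fun i hi => ?_, fun h0 => ?_⟩,
    fun V Γ Λ hP hD hΓ hΛ => PartitionedMicrogrid.isADMM_of_steps hκ hP hD hΓ hΛ, ?_⟩
  · obtain ⟨k, rfl⟩ := Nat.exists_eq_add_of_lt hi
    rw [zero_add]
    exact h.primalStep_of_eq hκ _ (h.coupVec_eq_avgVec hκ hΓ hΛ k)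
  · exact h.primalStep_of_eq hκ 0 (D.coupVec_eq_iff.2 h0)
  · rintro V Γ Λ hP hD hΓ hΛ Vopt hopt ⟨Γs, Λs, hs⟩
    exact PartitionedMicrogrid.convergence_of_steps htree hC hκ hP hD hΓ hΛ hopt hs
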